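/- **Definitions.** A finite lattice $X$ with least element $\mathbf 0$ and greatest element $\mathbf 1$ is *ranked* if for every $x\in X$ all maximal chains from $\mathbf 0$ to $x$ have the same length, denoted $\rho(x)$. A *cellular pseudomanifold* is a finite ranked lattice $X$ such that for all $x<z$ in $X$: (i) if $\rho(z)=\rho(x)+2$, there are exactly two elements $y$ with $x<y<z$; (ii) if $\rho(z)>\rho(x)+2$, the following graph is connected: its vertices are the elements $\sigma\in[x,z]$ with $\rho(\sigma)=\rho(z)-1$, and $\sigma,\tau$ are adjacent if and only if $\rho(\sigma\wedge\tau)=\rho(z)-2$. Its dimension is $\rho(\mathbf 1)-2$, its vertices are the elements of rank $1$, and if it has dimension $d$ and $n$ vertices, its *excess* is $n-d-2$. Isomorphism means isomorphism of posets. A cellular pseudomanifold is a *polytopal sphere* if it is isomorphic to the poset of all closed faces (including $\emptyset$ and the polytope itself) of a convex polytope, ordered by inclusion. For $b\ge -1$, $S^{b}_{b+2}$ is the lattice of all subsets of a set of $b+2$ elements. The *direct product* $X\otimes Y$ is $X\times Y$ with the componentwise order, and the *join* $X * Y$ is the subposet of $X\otimes Y$ consisting of the pairs $(x,y)$ such that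 either both $x<\mathbf 1$ and $y<\mathbf 1$, or both $x=\mathbf 1$ and $y=\mathbf 1$. **Theorem.** Let $d\ge -1$ be an integer. Up to isomorphism, the $d$-dimensional cellular pseudomanifolds of excess $1$ (that is, with $d+3$ vertices) are exactly - the joins $S^{b_1}_{b_1+2} * S^{b_2}_{b_2+2}$, where $b_1,b_2$ are integers with $0\le b_1\le b_2$ and $b_1+b_2=d-1$, and - the direct products $\bigl(S^{d_1}_{d_1+2} * S^{d_2}_{d_2+2}\bigr)\otimes S^{d_3}_{d_3+2}$, where $d_1,d_2,d_3$ are integers with $0\le d_1\le d_2$, $-1\le d_3$ and $d_1+d_2+d_3=d-3$. These are mutually non-isomorphic (no join is isomorphic to a direct product, and different parameters give non-isomorphic members of each family), and each of them is a polytopal sphere. There are exactly $\bigl\lfloor\bigl(\tfrac{d+1}{2}\bigr)^2\bigr\rfloor$ isomorphism classes of $d$-dimensional cellular pseudomanifolds of excess $1$. -/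

import Mathlib

universe u v

namespace Cellular

/-! ### Ranked lattices -/

section Rank

variable (X : Type u) [Lattice X] [BoundedOrder X]

/-- The rank `ρ(x)` of an element: the length of a longest chain ending at `x`. -/
noncomputable def rank {X : Type u} [Preorder X] (x : X) : ℕ := (Order.height x).toNat

/-- A (finite) bounded lattice is ranked if, for every `x`, all the maximal chains
`0 = x₀ ⋖ x₁ ⋖ ⋯ ⋖ x_r = x` have the same length `r`, which is then the rank of `x`. -/
def IsRanked : Prop :=
  ∀ (x : X) (s : RelSeries {p : X × X | p.1 ⋖ p.2}),
    s.head = ⊥ → s.last = x → s.length = rank x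

variable {X}

/-- The graph `Λ([x, z])` of an interval: its vertices are the elements of `[x, z]` of corank one,
two of them being adjacent when their meet has corank two. Ranks and meets are computed
in the whole lattice; for `x ≤ z`, ranks in `[x, z]` differ from these by the constant `ρ(x)`, and
meets agree. -/
def facetGraph (x z : X) : SimpleGraph {σ : X // σ ∈ Set.Icc x z ∧ rank σ + 1 = rank z} where
  Adj σ τ := rank ((σ : X) ⊓ (τ : X)) + 2 = rank z
  symm := ⟨fun σ τ h => by rwa [inf_comm]⟩
  loopless := ⟨fun σ h => by
    have h1 := σ.2.2
    rw [inf_idem] at h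
    omega⟩

variable (X)

/-- Cellular pseudomanifolds (abstract polytopes that are lattices). -/
structure IsCellularPseudomanifold : Prop where
  finite : Finite X
  ranked : IsRanked X
  diamond : ∀ x z : X, x < z → rank z = rank x + 2 → {y : X | x < y ∧ y < z}.ncard = 2
  connected : ∀ x z : X, x < z → rank x + 2 < rank z → (facetGraph x z).Connected

/-- The dimension of `M`: one less than `dim 1 = ρ(1) - 1`. -/
noncomputable def dim : ℤ := (rank (⊤ : X) : ℤ) - 2

/-- The number of vertices, i.e. of faces of dimension `0` (rank one). -/
noncomputable def numVertices : ℕ := {x : X | rank x = 1}.ncard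

/-- The excess `n - d - 2`. -/
noncomputable def excess : ℤ := (numVertices X : ℤ) - dim X - 2

/-- Polytopal spheres: cellular pseudomanifolds isomorphic to the boundary complex of a polytope,
a polytope being the convex hull of finitely many points of `ℝᵏ`, with non-empty
interior. Its boundary complex is the poset of its closed faces ordered by inclusion; the closed
faces are its exposed subsets in Mathlib's sense (the sets where a linear functional attains its
maximum on the polytope, which includes the polytope itself, and the empty set). -/
def IsPolytopalSphere : Prop :=
  IsCellularPseudomanifold X ∧
    ∃ (k : ℕ) (S : Finset (EuclideanSpace ℝ (Fin k))),
      (interior (convexHull ℝ (S : Set (EuclideanSpace ℝ (Fin k))))).Nonempty ∧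
      Nonempty (X ≃o {F : Set (EuclideanSpace ℝ (Fin k)) //
        IsExposed ℝ (convexHull ℝ (S : Set (EuclideanSpace ℝ (Fin k)))) F})

end Rank

/-! ### The standard spheres, direct products and joins -/

/-- The standard sphere `S^b_{b+2}` (for `b ≥ -1`): all subsets of a set with `b + 2` elements. -/
abbrev StdSphere (b : ℤ) : Type := Finset (Fin (b + 2).toNat)

/-- The direct product `X ⊗ Y`: the product set with the componentwise order. -/
abbrev DirectProduct (X : Type u) (Y : Type v) : Type (max u v) := X × Y

section Join

variable (X : Type u) (Y : Type v) [Lattice X] [BoundedOrder X] [Lattice Y] [BoundedOrder Y]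

/-- The join `X * Y`: the pairs in `X ⊗ Y` with both entries `< 1` or both entries `= 1`. -/
def Join : Type (max u v) :=
  {p : DirectProduct X Y // (p.1 < ⊤ ∧ p.2 < ⊤) ∨ (p.1 = ⊤ ∧ p.2 = ⊤)}

/-- The order on the join is the one induced from the direct product. -/
instance : PartialOrder (Join X Y) :=
  inferInstanceAs (PartialOrder
    {p : DirectProduct X Y // (p.1 < ⊤ ∧ p.2 < ⊤) ∨ (p.1 = ⊤ ∧ p.2 = ⊤)})

variable {X Y}

theorem Join.inf_mem {p q : DirectProduct X Y}
    (hp : (p.1 < ⊤ ∧ p.2 < ⊤) ∨ (p.1 = ⊤ ∧ p.2 = ⊤))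
    (hq : (q.1 < ⊤ ∧ q.2 < ⊤) ∨ (q.1 = ⊤ ∧ q.2 = ⊤)) :
    ((p ⊓ q).1 < ⊤ ∧ (p ⊓ q).2 < ⊤) ∨ ((p ⊓ q).1 = ⊤ ∧ (p ⊓ q).2 = ⊤) := by
  rcases hp with hp | hp
  · exact Or.inl ⟨lt_of_le_of_lt inf_le_left hp.1, lt_of_le_of_lt inf_le_left hp.2⟩
  · rcases hq with hq | hq
    · exact Or.inl ⟨lt_of_le_of_lt inf_le_right hq.1, lt_of_le_of_lt inf_le_right hq.2⟩
    · exact Or.inr ⟨by simp [hp.1, hq.1], by simp [hp.2, hq.2]⟩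

open Classical in
/-- The join is a lattice for the order above: meets are componentwise, and so are joins as long
as both entries stay below `1`. -/
noncomputable instance : Lattice (Join X Y) where
  inf p q := ⟨p.1 ⊓ q.1, Join.inf_mem p.2 q.2⟩
  inf_le_left p q := (inf_le_left : p.1 ⊓ q.1 ≤ p.1)
  inf_le_right p q := (inf_le_right : p.1 ⊓ q.1 ≤ q.1)
  le_inf p q r h1 h2 := (le_inf h1 h2 : p.1 ≤ q.1 ⊓ r.1)
  sup p q :=
    if h : (p.1 ⊔ q.1).1 < ⊤ ∧ (p.1 ⊔ q.1).2 < ⊤ then ⟨p.1 ⊔ q.1, Or.inl h⟩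
    else ⟨⊤, Or.inr ⟨rfl, rfl⟩⟩
  le_sup_left p q := by
    change p.1 ≤ Subtype.val (dite _ _ _)
    split_ifs
    · exact le_sup_left
    · exact le_top
  le_sup_right p q := by
    change q.1 ≤ Subtype.val (dite _ _ _)
    split_ifs
    · exact le_sup_right
    · exact le_top
  sup_le p q r h1 h2 := by
    have h3 : p.1 ⊔ q.1 ≤ r.1 := sup_le h1 h2
    change Subtype.val (dite _ _ _) ≤ r.1
    split_ifs with h
    · exact h3
    · rcases r.2 with hr | hr
      · exact absurd ⟨lt_of_le_of_lt h3.1 hr.1, lt_of_le_of_lt h3.2 hr.2⟩ h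
      · exact ⟨hr.1.ge, hr.2.ge⟩

open Classical in
/-- The top of the join is `(1, 1)` and its bottom is `(0, 0)` (except in the degenerate case where
`0 = 1` in `X` or `Y`, when the join is a single point). -/
noncomputable instance : BoundedOrder (Join X Y) where
  top := ⟨⊤, Or.inr ⟨rfl, rfl⟩⟩
  le_top p := (le_top : p.1 ≤ ⊤)
  bot := if h : (⊥ : X) < ⊤ ∧ (⊥ : Y) < ⊤ then ⟨⊥, Or.inl h⟩ else ⟨⊤, Or.inr ⟨rfl, rfl⟩⟩
  bot_le p := by
    change Subtype.val (dite _ _ _) ≤ p.1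
    split_ifs with h
    · exact bot_le
    · rcases p.2 with hp | hp
      · exact absurd ⟨lt_of_le_of_lt bot_le hp.1, lt_of_le_of_lt bot_le hp.2⟩ h
      · exact ⟨hp.1.ge, hp.2.ge⟩

end Join

/-! ### Isomorphism classes -/

/-- A `d`-dimensional cellular pseudomanifold of excess `e`, bundled with its set of faces. -/
structure CellularPseudomanifold (d e : ℤ) where
  carrier : Type u
  [lattice : Lattice carrier]
  [boundedOrder : BoundedOrder carrier]
  isCellularPseudomanifold : IsCellularPseudomanifold carrier
  dim_eq : dim carrier = d
  excess_eq : excess carrier = e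

attribute [instance] CellularPseudomanifold.lattice CellularPseudomanifold.boundedOrder

/-- Two cellular pseudomanifolds are identified when there is a cellular isomorphism between them,
i.e. a bijection of their sets of faces that preserves and reflects the order. -/
instance isoSetoid (d e : ℤ) : Setoid (CellularPseudomanifold.{u} d e) where
  r M N := Nonempty (M.carrier ≃o N.carrier)
  iseqv :=
    { refl := fun M => ⟨OrderIso.refl M.carrier⟩
      symm := fun ⟨f⟩ => ⟨f.symm⟩
      trans := fun ⟨f⟩ ⟨g⟩ => ⟨f.trans g⟩ }

/-- The isomorphism classes of `d`-dimensional cellular pseudomanifolds of excess `e`. -/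
def IsoClasses (d e : ℤ) : Type (u + 1) := Quotient (isoSetoid.{u} d e)

end Cellular

open Cellular

/-! In a graded lattice with diamonds, every element of rank at least two is the join of two
elements below it, so a face is determined by its set of vertices
(`IsGraded.le_of_vertexSet_subset`). Passing to a facet lowers the rank by one and loses at least
one vertex, so the number of vertices minus the rank is monotone; a face where the two numbers agree
is a simplex.

Let `z` have one vertex more than its rank. If some facet is not a simplex, it also has one vertex
more than its rank, and `z` is a pyramid over it, which allows induction. Otherwise every facet is a
simplex and omits exactly two vertices. The two facets over each ridge then show that, given an
omitted pair `{a, b}` and a third vertex `c`, exactly one of `{a, c}` and `{b, c}` is omitted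
(`IsGraded.isMissingPair_triple`). The omitted pairs thus form a complete bipartite graph, and its
two sides `A`, `B` describe all faces: a vertex set is a face when it contains both blocks or
neither. The apices of the pyramids are unconstrained and give a Boolean factor. Every case is
therefore `SimplexJoinProd a b m`, the joins being `m = 0`.

Conversely, explicit rank functions verify the axioms. As a polytope, the lattice is realized by two
simplices, each with its vertices summing to zero, in complementary subspaces, followed by `m`
pyramids: a linear functional bounded by `c` on a block equals `c` on the whole block only when `c =
0`, a condition common to both blocks. For fixed dimension, the number of faces determines `a`, `b`,
`m`, which gives non-isomorphism and reduces the count of classes to a count of triples. -/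

namespace Cellular

/-! ### Graded lattices with diamonds -/

/-- A rank function on a bounded lattice whose intervals of length two are diamonds. -/
structure IsGraded (X : Type u) [Lattice X] [BoundedOrder X] (r : X → ℕ) : Prop where
  bot : r ⊥ = 0
  strictMono : StrictMono r
  exists_succ : ∀ x y : X, x < y → ∃ x', x < x' ∧ x' ≤ y ∧ r x' = r x + 1
  diamond : ∀ x z : X, x < z → r z = r x + 2 →
    ∃ y₁ y₂ : X, y₁ ≠ y₂ ∧ ∀ y, (x < y ∧ y < z) ↔ (y = y₁ ∨ y = y₂)

/-- Two facets of `z` are equal, or they meet in a ridge of `z`. -/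
def AdjOrEq {X : Type u} [Lattice X] (r : X → ℕ) (z σ τ : X) : Prop :=
  σ = τ ∨ r (σ ⊓ τ) + 2 = r z

/-- Any two facets are adjacent. -/
def HasAdjacentFacets (X : Type u) [Lattice X] (r : X → ℕ) : Prop :=
  ∀ z σ τ : X, σ ≤ z → τ ≤ z → r σ + 1 = r z → r τ + 1 = r z → AdjOrEq r z σ τ

/-- Facet graphs of intervals have diameter at most two. -/
def HasFacetDiameterTwo (X : Type u) [Lattice X] (r : X → ℕ) : Prop :=
  ∀ x z σ τ : X, x ≤ σ → x ≤ τ → σ ≤ z → τ ≤ z → r σ + 1 = r z → r τ + 1 = r z →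
    ∃ ρ, x ≤ ρ ∧ ρ ≤ z ∧ r ρ + 1 = r z ∧ AdjOrEq r z σ ρ ∧ AdjOrEq r z ρ τ

theorem HasAdjacentFacets.hasFacetDiameterTwo {X : Type u} [Lattice X] {r : X → ℕ}
    (h : HasAdjacentFacets X r) : HasFacetDiameterTwo X r :=
  fun _ z σ τ hxσ _ hσ hτ h1 h2 => ⟨σ, hxσ, hσ, h1, Or.inl rfl, h z σ τ hσ hτ h1 h2⟩

section Graded

variable {X : Type u} [Lattice X] [BoundedOrder X] {r : X → ℕ}

theorem IsGraded.covBy (h : IsGraded X r) {x y : X} (hxy : x ⋖ y) : r y = r x + 1 := by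
  obtain ⟨x', h1, h2, h3⟩ := h.exists_succ x y hxy.1
  rcases h2.eq_or_lt with rfl | h4
  · exact h3
  · exact absurd h4 (hxy.2 h1)

theorem IsGraded.eq_of_le (h : IsGraded X r) {x y : X} (hxy : x ≤ y) (hr : r y ≤ r x) :
    x = y := by
  rcases hxy.eq_or_lt with h1 | h1
  · exact h1
  · have := h.strictMono h1
    omega

theorem IsGraded.length_eq (h : IsGraded X r) (s : RelSeries {p : X × X | p.1 ⋖ p.2})
    (hs : s.head = ⊥) (i : Fin (s.length + 1)) : r (s i) = i := by
  induction i using Fin.induction with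
  | zero => exact (congrArg r hs).trans h.bot
  | succ i ih => rw [h.covBy (s.step i), ih]; simp

/-- Strict monotonicity bounds the length of chains below `x` by `r x`, and `exists_succ`, started
at the bottom, finds an element below `x` of every smaller rank. Heights can thus be replaced by
explicit rank functions. -/
theorem IsGraded.rank_eq (h : IsGraded X r) (x : X) : rank x = r x := by
  suffices Order.height x = (r x : ℕ∞) by rw [rank, this]; rfl
  suffices ∀ n (x : X), r x = n → Order.height x = (n : ℕ∞) from this _ x rfl
  intro n
  induction n using Nat.strong_induction_on with
  | _ n ih =>
    intro x hx
    apply le_antisymm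
    · rw [Order.height_le_coe_iff]
      intro y hy
      have := h.strictMono hy
      rw [ih (r y) (by omega) y rfl]
      exact_mod_cast (by omega)
    · rcases Nat.eq_zero_or_pos n with rfl | hn
      · simp
      · have hlt : ∀ k, k < n → ∃ w, w < x ∧ r w = k := by
          intro k
          induction k with
          | zero =>
            intro _
            refine ⟨⊥, bot_lt_iff_ne_bot.2 ?_, h.bot⟩
            rintro rfl
            have := h.bot
            omega
          | succ k ihk =>
            intro hk
            obtain ⟨w, hw, hr⟩ := ihk (by omega)
            obtain ⟨w', _, h2, h3⟩ := h.exists_succ w x hw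
            refine ⟨w', lt_of_le_of_ne h2 ?_, by omega⟩
            rintro rfl
            omega
        obtain ⟨w, hw, hr⟩ := hlt (n - 1) (by omega)
        have h1 := Order.height_add_one_le hw
        rw [ih (n - 1) (by omega) w hr] at h1
        have h2 : ((n - 1 : ℕ) : ℕ∞) + 1 = n := by exact_mod_cast (by omega)
        rwa [h2] at h1

theorem IsGraded.isRanked (h : IsGraded X r) : IsRanked X := by
  rintro x s hs rfl
  rw [h.rank_eq]
  exact (h.length_eq s hs (Fin.last _)).symm

theorem IsGraded.isCellularPseudomanifold [Finite X] (h : IsGraded X r)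
    (hd : HasFacetDiameterTwo X r) : IsCellularPseudomanifold X where
  finite := inferInstance
  ranked := h.isRanked
  diamond x z hxz hr := by
    rw [h.rank_eq, h.rank_eq] at hr
    obtain ⟨y₁, y₂, hne, hy⟩ := h.diamond x z hxz hr
    rw [Set.ncard_eq_two]
    exact ⟨y₁, y₂, hne, Set.ext hy⟩
  connected x z hxz hr := by
    have key : ∀ σ τ : {σ : X // σ ∈ Set.Icc x z ∧ rank σ + 1 = rank z},
        AdjOrEq r z σ.1 τ.1 → (facetGraph x z).Reachable σ τ := by
      rintro σ τ (hστ | hστ)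
      · rw [Subtype.ext hστ]
      · refine SimpleGraph.Adj.reachable ?_
        change rank (σ.1 ⊓ τ.1) + 2 = rank z
        rw [h.rank_eq (σ.1 ⊓ τ.1), hστ, h.rank_eq z]
    -- Connectedness also requires a vertex of the facet graph: climb from `x` towards `z` one rank
    -- at a time.
    have hne : ∃ σ, x ≤ σ ∧ σ ≤ z ∧ r σ + 1 = r z := by
      have hlt : ∀ k, r x + k < r z → ∃ w, x ≤ w ∧ w < z ∧ r w = r x + k := by
        intro k
        induction k with
        | zero => exact fun _ => ⟨x, le_rfl, hxz, rfl⟩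
        | succ k ihk =>
          intro hk
          obtain ⟨w, hw, hw', hr⟩ := ihk (by omega)
          obtain ⟨w', h1, h2, h3⟩ := h.exists_succ w z hw'
          refine ⟨w', hw.trans h1.le, lt_of_le_of_ne h2 ?_, by omega⟩
          rintro rfl
          omega
      have := h.strictMono hxz
      obtain ⟨w, h1, h2, h3⟩ := hlt (r z - r x - 1) (by omega)
      exact ⟨w, h1, h2.le, by omega⟩
    obtain ⟨σ₀, h1, h2, h3⟩ := hne
    rw [SimpleGraph.connected_iff]
    refine ⟨?_, ⟨⟨σ₀, ⟨h1, h2⟩, by rwa [h.rank_eq, h.rank_eq]⟩⟩⟩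
    rintro ⟨σ, hσ, hσr⟩ ⟨τ, hτ, hτr⟩
    have hσr' := hσr
    have hτr' := hτr
    rw [h.rank_eq, h.rank_eq] at hσr' hτr'
    obtain ⟨ρ, g1, g2, g3, g4, g5⟩ := hd x z σ τ hσ.1 hτ.1 hσ.2 hτ.2 hσr' hτr'
    have g6 : rank ρ + 1 = rank z := by rwa [h.rank_eq, h.rank_eq]
    exact (key ⟨σ, hσ, hσr⟩ ⟨ρ, ⟨g1, g2⟩, g6⟩ g4).trans (key _ ⟨τ, hτ, hτr⟩ g5)

theorem exists_covBy_series [Finite X] (x : X) :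
    ∃ s : RelSeries {p : X × X | p.1 ⋖ p.2}, s.head = ⊥ ∧ s.last = x := by
  induction x using WellFoundedLT.induction with
  | _ x ih =>
    rcases eq_or_ne x ⊥ with rfl | hx
    · exact ⟨RelSeries.singleton _ ⊥, rfl, rfl⟩
    · obtain ⟨w, -, hw⟩ := exists_le_covBy_of_lt (bot_lt_iff_ne_bot.2 hx)
      obtain ⟨s, h1, h2⟩ := ih w hw.1
      refine ⟨s.snoc x (by rw [h2]; exact hw), by simpa using h1, by simp⟩

theorem IsRanked.rank_covBy [Finite X] (h : IsRanked X) {x y : X} (hxy : x ⋖ y) :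
    rank y = rank x + 1 := by
  obtain ⟨s, h1, h2⟩ := exists_covBy_series x
  have h3 := h x s h1 h2
  have h4 := h y (s.snoc y (by rw [h2]; exact hxy)) (by simpa using h1) (by simp)
  rw [← h4, ← h3]
  rfl

theorem IsCellularPseudomanifold.isGraded (h : IsCellularPseudomanifold X) :
    IsGraded X rank := by
  have := h.finite
  refine ⟨by simp [rank], ?_, ?_, ?_⟩
  · intro x
    suffices ∀ y : X, x < y → rank x < rank y from fun y => this y
    intro y
    induction y using WellFoundedLT.induction with
    | _ y ih =>
      intro hxy
      obtain ⟨w, h1, h2⟩ := exists_le_covBy_of_lt hxy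
      rw [h.ranked.rank_covBy h2]
      rcases h1.eq_or_lt with rfl | h1
      · omega
      · have := ih w h2.1 h1
        omega
  · intro x y hxy
    obtain ⟨w, h1, h2⟩ := exists_covBy_le_of_lt hxy
    exact ⟨w, h1.1, h2, h.ranked.rank_covBy h1⟩
  · intro x z hxz hr
    have := h.diamond x z hxz hr
    rw [Set.ncard_eq_two] at this
    obtain ⟨y₁, y₂, h1, h2⟩ := this
    exact ⟨y₁, y₂, h1, fun y => by simpa using Set.ext_iff.1 h2 y⟩

end Graded

/-! ### Invariance under isomorphism -/

section Transport

theorem rank_orderIso {X : Type u} {Y : Type v} [PartialOrder X] [PartialOrder Y]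
    (f : X ≃o Y) (x : X) : rank (f x) = rank x := by
  rw [rank, rank, Order.height_orderIso]

variable {X : Type u} {Y : Type v} [Lattice X] [BoundedOrder X] [Lattice Y] [BoundedOrder Y]

theorem dim_congr (f : X ≃o Y) : dim X = dim Y := by
  rw [dim, dim, ← rank_orderIso f, map_top]

omit [BoundedOrder X] [BoundedOrder Y] in
theorem numVertices_congr (f : X ≃o Y) : numVertices X = numVertices Y := by
  rw [numVertices, numVertices, ← Nat.card_coe_set_eq, ← Nat.card_coe_set_eq]
  exact Nat.card_congr (f.toEquiv.subtypeEquiv fun x => by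
    simp [← rank_orderIso f])

theorem excess_congr (f : X ≃o Y) : excess X = excess Y := by
  rw [excess, excess, dim_congr f, numVertices_congr f]

theorem IsCellularPseudomanifold.congr (f : X ≃o Y) (h : IsCellularPseudomanifold X) :
    IsCellularPseudomanifold Y := by
  have hX := h.isGraded
  have := h.finite
  have hr : ∀ y : Y, rank (f.symm y) = rank y := rank_orderIso f.symm
  refine ⟨Finite.of_equiv X f.toEquiv, ?_, ?_, ?_⟩
  · intro y s hs hl
    have := h.ranked (f.symm y) (s.map ⟨f.symm, fun {a b} hab => by
      simpa using hab⟩) (by simp [hs]) (by simp [hl])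
    simpa [hr] using this
  · intro x z hxz hz
    rw [← h.diamond (f.symm x) (f.symm z) (by simpa using hxz) (by rw [hr, hr, hz]),
      ← Nat.card_coe_set_eq, ← Nat.card_coe_set_eq]
    exact (Nat.card_congr (f.toEquiv.subtypeEquiv fun x => by
      simp [OrderIso.symm_apply_lt, OrderIso.lt_symm_apply])).symm
  · intro x z hxz hz
    have hc := h.connected (f.symm x) (f.symm z) (by simpa using hxz) (by rwa [hr, hr])
    refine (SimpleGraph.Iso.connected_iff (⟨f.toEquiv.subtypeEquiv fun σ => ?_, ?_⟩ :
      facetGraph (f.symm x) (f.symm z) ≃g facetGraph x z)).1 hc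
    · simp [OrderIso.symm_apply_le, OrderIso.le_symm_apply, rank_orderIso, hr]
    · rintro ⟨σ, hσ⟩ ⟨τ, hτ⟩
      change rank (f σ ⊓ f τ) + 2 = rank z ↔ rank (σ ⊓ τ) + 2 = rank (f.symm z)
      rw [← map_inf, rank_orderIso, hr]

end Transport

/-! ### Faces as vertex sets, simplices and pyramids -/

section VertexSet

variable {X : Type u} [Lattice X] [BoundedOrder X] [Fintype X] {r : X → ℕ}

open Classical in
/-- The vertices below `x`. -/
noncomputable def vertexSet (r : X → ℕ) (x : X) : Finset X := {a | r a = 1 ∧ a ≤ x}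

omit [BoundedOrder X] in
theorem mem_vertexSet {x a : X} : a ∈ vertexSet r x ↔ r a = 1 ∧ a ≤ x := by
  simp [vertexSet]

omit [BoundedOrder X] in
theorem vertexSet_mono {x y : X} (h : x ≤ y) : vertexSet r x ⊆ vertexSet r y := by
  intro a
  rw [mem_vertexSet, mem_vertexSet]
  exact fun ha => ⟨ha.1, ha.2.trans h⟩

omit [BoundedOrder X] in
theorem mem_vertexSet_inf {x y a : X} :
    a ∈ vertexSet r (x ⊓ y) ↔ a ∈ vertexSet r x ∧ a ∈ vertexSet r y := by
  simp only [mem_vertexSet, le_inf_iff]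
  tauto

theorem IsGraded.exists_coatom (h : IsGraded X r) {x z : X} (hxz : x < z) :
    ∃ F, x ≤ F ∧ F < z ∧ r F + 1 = r z := by
  obtain ⟨F, h1, h2⟩ := exists_le_covBy_of_lt hxz
  exact ⟨F, h1, h2.1, (h.covBy h2).symm⟩

/-- The two elements of a diamond between a ridge of `x` and `x` both have rank `r x - 1`; being
distinct, they can only have `x` as their join. -/
theorem IsGraded.exists_two_coatoms (h : IsGraded X r) {x : X} (hx : 2 ≤ r x) :
    ∃ y₁ y₂ : X, y₁ < x ∧ y₂ < x ∧ y₁ ⊔ y₂ = x := by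
  have hlt : ⊥ < x := bot_lt_iff_ne_bot.2 (by rintro rfl; have := h.bot; omega)
  obtain ⟨F, -, hF, hrF⟩ := h.exists_coatom hlt
  have hlt' : ⊥ < F := bot_lt_iff_ne_bot.2 (by rintro rfl; have := h.bot; omega)
  obtain ⟨R, -, hR, hrR⟩ := h.exists_coatom hlt'
  obtain ⟨y₁, y₂, hne, hy⟩ := h.diamond R x (hR.trans hF) (by omega)
  obtain ⟨h1, h1'⟩ := (hy y₁).2 (Or.inl rfl)
  obtain ⟨h2, h2'⟩ := (hy y₂).2 (Or.inr rfl)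
  refine ⟨y₁, y₂, h1', h2', h.eq_of_le (sup_le h1'.le h2'.le) ?_⟩
  have a1 := h.strictMono h1
  have a2 := h.strictMono h2
  have a3 := h.strictMono h1'
  have a4 := h.strictMono h2'
  have h3 : y₁ < y₁ ⊔ y₂ := by
    refine lt_of_le_of_ne le_sup_left fun he => hne ?_
    exact (h.eq_of_le (he ▸ le_sup_right : y₂ ≤ y₁) (by omega)).symm
  have := h.strictMono h3
  omega

/-- By induction on `x`: ranks zero and one are immediate, and above that `x` is the join of two
smaller elements to which the induction applies. -/
theorem IsGraded.le_of_vertexSet_subset (h : IsGraded X r) {x y : X}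
    (hxy : vertexSet r x ⊆ vertexSet r y) : x ≤ y := by
  induction x using WellFoundedLT.induction with
  | _ x ih =>
    rcases Nat.lt_or_ge (r x) 2 with hx | hx
    · rcases Nat.lt_or_ge (r x) 1 with hx' | hx'
      · rw [← h.eq_of_le (bot_le : ⊥ ≤ x) (by omega)]
        exact bot_le
      · exact (mem_vertexSet.1 (hxy (mem_vertexSet.2 ⟨by omega, le_rfl⟩))).2
    · obtain ⟨y₁, y₂, h1, h2, h3⟩ := h.exists_two_coatoms hx
      rw [← h3]
      exact sup_le (ih y₁ h1 ((vertexSet_mono h1.le).trans hxy))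
        (ih y₂ h2 ((vertexSet_mono h2.le).trans hxy))

theorem IsGraded.vertexSet_subset_iff (h : IsGraded X r) {x y : X} :
    vertexSet r x ⊆ vertexSet r y ↔ x ≤ y :=
  ⟨h.le_of_vertexSet_subset, vertexSet_mono⟩

theorem IsGraded.vertexSet_injective (h : IsGraded X r) : Function.Injective (vertexSet r) :=
  fun _ _ hxy => le_antisymm (h.le_of_vertexSet_subset hxy.le) (h.le_of_vertexSet_subset hxy.ge)

theorem IsGraded.card_vertexSet_lt (h : IsGraded X r) {x y : X} (hxy : x < y) :
    (vertexSet r x).card < (vertexSet r y).card :=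
  Finset.card_lt_card (lt_of_le_of_ne (vertexSet_mono hxy.le)
    fun he => hxy.ne (h.vertexSet_injective he))

/-- This is monotonicity of the number of vertices minus the rank, written without subtraction: each
step down to a facet costs one rank and at least one vertex. -/
theorem IsGraded.card_vertexSet_add_le (h : IsGraded X r) {x y : X} (hxy : x ≤ y) :
    (vertexSet r x).card + r y ≤ (vertexSet r y).card + r x := by
  induction y using WellFoundedLT.induction with
  | _ y ih =>
    rcases hxy.eq_or_lt with rfl | hlt
    · exact le_rfl
    · obtain ⟨F, h1, h2, h3⟩ := h.exists_coatom hlt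
      have := ih F h2 h1
      have := h.card_vertexSet_lt h2
      omega

theorem IsGraded.rank_le_card_vertexSet (h : IsGraded X r) (x : X) :
    r x ≤ (vertexSet r x).card := by
  have := h.card_vertexSet_add_le (bot_le : ⊥ ≤ x)
  have := h.bot
  omega

omit [Fintype X] in
/-- The other facet of `z` containing a given ridge. -/
theorem IsGraded.exists_other (h : IsGraded X r) {R F z : X} (hR : R < F) (hF : F < z)
    (hr : r z = r R + 2) :
    ∃ F', F' ≠ F ∧ R < F' ∧ F' < z ∧ ∀ y, R < y → y < z → y = F ∨ y = F' := by
  obtain ⟨y₁, y₂, hne, hy⟩ := h.diamond R z (hR.trans hF) hr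
  rcases (hy F).1 ⟨hR, hF⟩ with rfl | rfl
  · have h2 := (hy y₂).2 (Or.inr rfl)
    exact ⟨y₂, hne.symm, h2.1, h2.2, fun y h3 h4 => (hy y).1 ⟨h3, h4⟩⟩
  · have h2 := (hy y₁).2 (Or.inl rfl)
    exact ⟨y₁, hne, h2.1, h2.2, fun y h3 h4 => ((hy y).1 ⟨h3, h4⟩).symm⟩

open Classical in
-- Any facet `F` of `x` again has as many vertices as its rank. If `F` avoids `b`, it is the
-- required face. Otherwise induction gives the ridge `R` obtained by erasing `b` from `F`, and the
-- other facet of `x` over `R` must avoid `b`, since it would otherwise contain `F`.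
theorem IsGraded.exists_vertexSet_eq_erase (h : IsGraded X r) {x : X}
    (hx : (vertexSet r x).card = r x) {b : X} (hb : b ∈ vertexSet r x) :
    ∃ y, vertexSet r y = (vertexSet r x).erase b := by
  induction x using WellFoundedLT.induction with
  | _ x ih =>
    have hb' := mem_vertexSet.1 hb
    have hbx := h.strictMono.monotone hb'.2
    have hlt : ⊥ < x := bot_lt_iff_ne_bot.2 (by rintro rfl; have := h.bot; omega)
    obtain ⟨F, -, hF, hrF⟩ := h.exists_coatom hlt
    have hFc : (vertexSet r F).card = r F := by
      have := h.card_vertexSet_add_le hF.le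
      have := h.rank_le_card_vertexSet F
      omega
    by_cases hbF : b ∈ vertexSet r F
    · obtain ⟨R, hR⟩ := ih F hF hFc hbF
      have hRF : R ≤ F := h.le_of_vertexSet_subset (hR ▸ Finset.erase_subset _ _)
      have hRc := Finset.card_erase_of_mem hbF
      have h1 := Finset.card_pos.2 ⟨b, hbF⟩
      rw [← hR] at hRc
      have hRr : r R + 1 = r F := by
        have := h.card_vertexSet_add_le hRF
        have := h.rank_le_card_vertexSet R
        omega
      have hRF' : R < F := lt_of_le_of_ne hRF (by rintro rfl; omega)
      obtain ⟨F', hne, h2, h3, -⟩ := h.exists_other hRF' hF (by omega)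
      have hF'r : r F' = r F := by
        have := h.strictMono h2
        have := h.strictMono h3
        omega
      have hbF' : b ∉ vertexSet r F' := by
        intro hb2
        apply hne
        refine (h.eq_of_le (h.le_of_vertexSet_subset ?_) hF'r.le).symm
        intro c hc
        by_cases hcb : c = b
        · rwa [hcb]
        · exact vertexSet_mono h2.le (hR ▸ Finset.mem_erase.2 ⟨hcb, hc⟩)
      refine ⟨F', Finset.eq_of_subset_of_card_le
        (Finset.subset_erase.2 ⟨vertexSet_mono h3.le, hbF'⟩) ?_⟩
      rw [Finset.card_erase_of_mem hb]
      have := h.rank_le_card_vertexSet F'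
      omega
    · refine ⟨F, Finset.eq_of_subset_of_card_le
        (Finset.subset_erase.2 ⟨vertexSet_mono hF.le, hbF⟩) ?_⟩
      rw [Finset.card_erase_of_mem hb]
      omega

/-- A face of excess zero is a simplex. -/
theorem IsGraded.exists_vertexSet_eq_of_card_eq (h : IsGraded X r) {x : X}
    (hx : (vertexSet r x).card = r x) {s : Finset X} (hs : s ⊆ vertexSet r x) :
    ∃ y, vertexSet r y = s := by
  classical
  induction x using WellFoundedLT.induction with
  | _ x ih =>
    rcases hs.eq_or_ssubset with rfl | hs'
    · exact ⟨x, rfl⟩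
    · obtain ⟨b, hb, hbs⟩ := Finset.exists_of_ssubset hs'
      obtain ⟨y, hy⟩ := h.exists_vertexSet_eq_erase hx hb
      have hyx : y ≤ x := h.le_of_vertexSet_subset (hy ▸ Finset.erase_subset _ _)
      have hlt : y < x := lt_of_le_of_ne hyx (by
        rintro rfl
        rw [hy] at hb
        exact Finset.notMem_erase _ _ hb)
      refine ih y hlt ?_ (hy ▸ Finset.subset_erase.2 ⟨hs, hbs⟩)
      have := h.card_vertexSet_add_le hyx
      have := h.rank_le_card_vertexSet y
      omega

/-- If the facet `F` of `z` misses the single vertex `a`, then `z` is a pyramid over `F`. -/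
theorem IsGraded.exists_vertexSet_eq_insert [DecidableEq X] (h : IsGraded X r) {F z a : X}
    (hF : F < z) (hr : r F + 1 = r z) (ha : a ∉ vertexSet r F)
    (hz : vertexSet r z = insert a (vertexSet r F)) {x : X} (hx : x ≤ F) :
    ∃ y, vertexSet r y = insert a (vertexSet r x) := by
  induction x using WellFoundedGT.induction with
  | _ x ih =>
    rcases hx.eq_or_lt with rfl | hlt
    · exact ⟨z, hz⟩
    · obtain ⟨w, hw, hwF, hrw⟩ := h.exists_succ x F hlt
      rcases hwF.eq_or_lt with rfl | hwF
      -- Here `x` is a facet of the base. The other facet `R'` of `z` over `x` contains the apex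
      -- `a`, for otherwise its vertices would all lie in the base; it meets the base in `x`.
      · obtain ⟨R', hne, h1, h2, -⟩ := h.exists_other hlt hF (by omega)
        have hR'r : r R' = r w := by
          have := h.strictMono h1
          have := h.strictMono h2
          omega
        have hnle : ¬ R' ≤ w := fun hle => hne (h.eq_of_le hle hR'r.ge)
        have haR' : a ∈ vertexSet r R' := by
          by_contra haR'
          refine hnle (h.le_of_vertexSet_subset ?_)
          have h3 := vertexSet_mono (r := r) h2.le
          rw [hz] at h3
          intro c hc
          rcases Finset.mem_insert.1 (h3 hc) with rfl | h4
          · exact absurd hc haR'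
          · exact h4
        have hinf : x = R' ⊓ w := by
          refine h.eq_of_le (le_inf h1.le hlt.le) ?_
          have : R' ⊓ w < w := lt_of_le_of_ne inf_le_right fun he => hnle (by
            rw [h.eq_of_le (inf_eq_right.1 he) hR'r.le])
          have := h.strictMono this
          omega
        refine ⟨R', ?_⟩
        ext c
        have h3 := @vertexSet_mono _ _ _ r _ _ h2.le c
        rw [hz, Finset.mem_insert] at h3
        rw [Finset.mem_insert, hinf, mem_vertexSet_inf]
        constructor
        · intro hc
          rcases h3 hc with h4 | h4
          · exact Or.inl h4
          · exact Or.inr ⟨hc, h4⟩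
        · rintro (rfl | hc)
          · exact haR'
          · exact hc.1
      -- Here `x` has corank at least two in the base, so it is the meet of two elements `w`, `w'`
      -- of the base, and the meet of the pyramids over these is the pyramid over `x`.
      · obtain ⟨u, hu, huF, hru⟩ := h.exists_succ w F hwF
        obtain ⟨w', hne, h1, h2, -⟩ := h.exists_other hw hu (by omega)
        obtain ⟨y₁, hy₁⟩ := ih w hw hwF.le
        obtain ⟨y₂, hy₂⟩ := ih w' h1 (h2.le.trans huF)
        have hw'r : r w' = r w := by
          have := h.strictMono h1
          have := h.strictMono h2
          omega
        have hinf : x = w ⊓ w' := by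
          refine h.eq_of_le (le_inf hw.le h1.le) ?_
          have : w ⊓ w' < w := lt_of_le_of_ne inf_le_left fun he =>
            hne (h.eq_of_le (inf_eq_left.1 he) hw'r.le).symm
          have := h.strictMono this
          omega
        refine ⟨y₁ ⊓ y₂, ?_⟩
        ext c
        rw [mem_vertexSet_inf, hy₁, hy₂, hinf]
        simp only [Finset.mem_insert, mem_vertexSet_inf]
        tauto

end VertexSet

/-! ### The two blocks of a face of excess one -/

section Blocks

variable {X : Type u} [Lattice X] [BoundedOrder X] [Fintype X] [DecidableEq X] {r : X → ℕ}

/-- `a` and `b` are vertices of `z`, and all the other vertices of `z` make up a face. -/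
def IsMissingPair (r : X → ℕ) (z a b : X) : Prop :=
  a ∈ vertexSet r z ∧ b ∈ vertexSet r z ∧ a ≠ b ∧ ∃ x, vertexSet r x = vertexSet r z \ {a, b}

omit [BoundedOrder X] in
theorem IsMissingPair.symm {z a b : X} (h : IsMissingPair r z a b) : IsMissingPair r z b a :=
  ⟨h.2.1, h.1, h.2.2.1.symm, by rw [Finset.pair_comm]; exact h.2.2.2⟩

theorem card_sdiff_pair {α : Type*} [DecidableEq α] {U : Finset α} {a b : α} (ha : a ∈ U)
    (hb : b ∈ U) (hab : a ≠ b) : (U \ {a, b}).card + 2 = U.card := by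
  rw [← Finset.card_pair hab]
  exact Finset.card_sdiff_add_card_eq_card (by
    intro c hc
    rcases Finset.mem_insert.1 hc with rfl | hc
    · exact ha
    · rwa [Finset.mem_singleton.1 hc])

/-- A face of excess one all of whose facets are simplices. -/
structure IsSimplicialExcessOne (r : X → ℕ) (z : X) : Prop where
  card_eq : (vertexSet r z).card = r z + 1
  facet : ∀ F, F < z → r F + 1 = r z → (vertexSet r F).card = r F

variable {z : X}

/-- A facet containing `x` is a simplex with `r z - 1` of the `r z + 1` vertices of `z`, so it omits
exactly two. -/
theorem IsGraded.exists_isMissingPair (h : IsGraded X r) (hz : IsSimplicialExcessOne r z)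
    {x : X} (hx : x < z) :
    ∃ a b, IsMissingPair r z a b ∧ a ∉ vertexSet r x ∧ b ∉ vertexSet r x := by
  obtain ⟨F, h1, h2, h3⟩ := h.exists_coatom hx
  have h4 := hz.facet F h2 h3
  have h5 := hz.card_eq
  have hsub := vertexSet_mono (r := r) h2.le
  have h6 := Finset.card_sdiff_add_card_eq_card hsub
  obtain ⟨a, b, hab, he⟩ := Finset.card_eq_two.1
    (show (vertexSet r z \ vertexSet r F).card = 2 by omega)
  have ha : a ∈ vertexSet r z \ vertexSet r F := he ▸ Finset.mem_insert_self _ _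
  have hb : b ∈ vertexSet r z \ vertexSet r F := by rw [he]; simp
  rw [Finset.mem_sdiff] at ha hb
  refine ⟨a, b, ⟨ha.1, hb.1, hab, F, ?_⟩, fun hc => ha.2 (vertexSet_mono h1 hc),
    fun hc => hb.2 (vertexSet_mono h1 hc)⟩
  rw [← he, Finset.sdiff_sdiff_eq_self hsub]

/-- The face complementary to the pair has `r z - 1` vertices, as many as any facet containing it,
so it is that facet. -/
theorem IsGraded.exists_facet_of_isMissingPair (h : IsGraded X r)
    (hz : IsSimplicialExcessOne r z) {a b : X} (hab : IsMissingPair r z a b) :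
    ∃ F, F < z ∧ r F + 1 = r z ∧ vertexSet r F = vertexSet r z \ {a, b} := by
  obtain ⟨ha, hb, hne, x, hx⟩ := hab
  have hc := card_sdiff_pair ha hb hne
  rw [← hx] at hc
  have hxz : x < z := by
    refine lt_of_le_of_ne (h.le_of_vertexSet_subset (hx ▸ Finset.sdiff_subset)) ?_
    rintro rfl
    omega
  obtain ⟨F, h1, h2, h3⟩ := h.exists_coatom hxz
  have h4 := hz.facet F h2 h3
  have h5 := hz.card_eq
  have h6 := Finset.eq_of_subset_of_card_le (vertexSet_mono (r := r) h1) (by omega)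
  exact ⟨F, h2, h3, h6 ▸ hx⟩

theorem IsGraded.exists_vertexSet_eq_of_isMissingPair (h : IsGraded X r)
    (hz : IsSimplicialExcessOne r z) {a b : X} (hab : IsMissingPair r z a b) {s : Finset X}
    (hs : s ⊆ vertexSet r z) (ha : a ∉ s) (hb : b ∉ s) : ∃ x, vertexSet r x = s := by
  obtain ⟨F, h1, h2, h3⟩ := h.exists_facet_of_isMissingPair hz hab
  refine h.exists_vertexSet_eq_of_card_eq (hz.facet F h1 h2) ?_
  rw [h3]
  intro c hc
  rw [Finset.mem_sdiff]
  refine ⟨hs hc, ?_⟩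
  rw [Finset.mem_insert, Finset.mem_singleton]
  rintro (rfl | rfl)
  · exact ha hc
  · exact hb hc

/-- Erasing `c` from the facet complementary to `{a, b}` gives a ridge `R`, the complement of `{a,
b, c}`. It lies in exactly one other facet `F'`, and the pair omitted by `F'` is one of `{a, c}`,
`{b, c}`. This makes the omitted pairs a complete bipartite graph. -/
theorem IsGraded.isMissingPair_triple (h : IsGraded X r)
    (hz : IsSimplicialExcessOne r z) {a b c : X} (hab : IsMissingPair r z a b)
    (hc : c ∈ vertexSet r z) (hca : c ≠ a) (hcb : c ≠ b) :
    IsMissingPair r z a c ↔ ¬ IsMissingPair r z b c := by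
  obtain ⟨ha, hb, hne, -⟩ := id hab
  obtain ⟨F, hF, hFr, hFs⟩ := h.exists_facet_of_isMissingPair hz hab
  obtain ⟨R, hR⟩ := h.exists_vertexSet_eq_of_isMissingPair hz hab
    (s := vertexSet r z \ {a, b, c}) Finset.sdiff_subset (by simp) (by simp)
  have hcF : c ∈ vertexSet r F := by rw [hFs]; simp [hc, hca, hcb]
  have hRF' : vertexSet r R = (vertexSet r F).erase c := by
    rw [hR, hFs]; ext; simp; tauto
  have hRF : R < F := by
    refine lt_of_le_of_ne (h.le_of_vertexSet_subset (hRF' ▸ Finset.erase_subset _ _)) ?_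
    rintro rfl
    exact Finset.notMem_erase _ _ (hRF' ▸ hcF)
  have hRc := Finset.card_erase_of_mem hcF
  rw [← hRF'] at hRc
  have hpos := Finset.card_pos.2 ⟨c, hcF⟩
  have hFc := hz.facet F hF hFr
  have hzc := hz.card_eq
  have hRr : r R + 1 = r F := by
    have := h.card_vertexSet_add_le hRF.le
    have := h.rank_le_card_vertexSet R
    omega
  obtain ⟨F', hne', h1, h2, h3⟩ := h.exists_other hRF hF (by omega)
  have hF'r : r F' + 1 = r z := by
    have := h.strictMono h1
    have := h.strictMono h2
    omega
  -- A facet omitting `{a, c}` or `{b, c}` contains `R` but not `c`, so it is not `F` and must be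
  -- `F'`.
  have hRc' : ∀ G, IsMissingPair r z a c ∧ vertexSet r G = vertexSet r z \ {a, c} ∨
      IsMissingPair r z b c ∧ vertexSet r G = vertexSet r z \ {b, c} → G < z → G = F' := by
    intro G hG hGz
    have hcG : c ∉ vertexSet r G := by rcases hG with hG | hG <;> rw [hG.2] <;> simp
    have hRG : R < G := by
      refine lt_of_le_of_ne (h.le_of_vertexSet_subset ?_) ?_
      · rcases hG with hG | hG <;> rw [hG.2, hR] <;>
          refine Finset.sdiff_subset_sdiff le_rfl ?_ <;> intro d <;> simp <;> tauto
      · rintro rfl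
        have hG' : a ∈ vertexSet r R ∨ b ∈ vertexSet r R := by
          rcases hG with hG | hG
          · right; rw [hG.2]; simp [hb, hne.symm, hcb.symm]
          · left; rw [hG.2]; simp [ha, hne, hca.symm]
        rw [hR] at hG'
        simp at hG'
    rcases h3 G hRG hGz with rfl | h4
    · exact absurd hcF hcG
    · exact h4
  constructor
  · intro hac hbc
    obtain ⟨G, hG, hGr, hGs⟩ := h.exists_facet_of_isMissingPair hz hac
    obtain ⟨K, hK, hKr, hKs⟩ := h.exists_facet_of_isMissingPair hz hbc
    have e1 := hRc' G (Or.inl ⟨hac, hGs⟩) hG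
    have e2 := hRc' K (Or.inr ⟨hbc, hKs⟩) hK
    have : a ∈ vertexSet r K := by rw [hKs]; simp [ha, hne, hca.symm]
    rw [e2, ← e1, hGs] at this
    simp at this
  · intro hbc
    -- Existence: the pair omitted by `F'` lies within `{a, b, c}`, and it is not `{a, b}` because
    -- `F'` differs from `F`.
    obtain ⟨p, q, hpq, hp, hq⟩ := h.exists_isMissingPair hz h2
    have hpq' : ∀ d, d ∉ vertexSet r F' → d ∈ vertexSet r z → d = a ∨ d = b ∨ d = c := by
      intro d hd hdz
      by_contra hcon
      refine hd (vertexSet_mono h1.le ?_)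
      rw [hR]
      simp only [Finset.mem_sdiff, Finset.mem_insert, Finset.mem_singleton]
      exact ⟨hdz, hcon⟩
    have key : ¬ (a ∉ vertexSet r F' ∧ b ∉ vertexSet r F') := by
      rintro ⟨haF, hbF⟩
      apply hne'
      refine h.eq_of_le (h.le_of_vertexSet_subset ?_) (by omega)
      rw [hFs]
      intro d hd
      simp only [Finset.mem_sdiff, Finset.mem_insert, Finset.mem_singleton]
      refine ⟨vertexSet_mono h2.le hd, ?_⟩
      rintro (rfl | rfl)
      · exact haF hd
      · exact hbF hd
    have hne2 := hpq.2.2.1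
    rcases hpq' p hp hpq.1 with rfl | rfl | rfl <;>
      rcases hpq' q hq hpq.2.1 with rfl | rfl | rfl
    · exact absurd rfl hne2
    · exact absurd ⟨hp, hq⟩ key
    · exact hpq
    · exact absurd ⟨hq, hp⟩ key
    · exact absurd rfl hne2
    · exact absurd hpq hbc
    · exact hpq.symm
    · exact absurd hpq.symm hbc
    · exact absurd rfl hne2

/-- The faces of `z` are the sets of vertices which contain both or none of two disjoint blocks. -/
def HasBlocks (r : X → ℕ) (z : X) (A B : Finset X) : Prop :=
  A ⊆ vertexSet r z ∧ B ⊆ vertexSet r z ∧ Disjoint A B ∧ 2 ≤ A.card ∧ 2 ≤ B.card ∧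
    ∀ s ⊆ vertexSet r z, (∃ x, vertexSet r x = s) ↔ (A ⊆ s ↔ B ⊆ s)

omit [DecidableEq X] in
theorem IsGraded.vertexSet_eq_singleton (h : IsGraded X r) {a : X} (ha : r a = 1) :
    vertexSet r a = {a} := by
  ext b
  rw [mem_vertexSet, Finset.mem_singleton]
  constructor
  · rintro ⟨h1, h2⟩
    exact h.eq_of_le h2 (by omega)
  · rintro rfl
    exact ⟨ha, le_rfl⟩

/-- The blocks are the two colour classes of the graph of omitted pairs, a vertex being coloured by
whether it forms an omitted pair with a fixed `b₀`. -/
theorem IsGraded.hasBlocks_of_isSimplicialExcessOne (h : IsGraded X r)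
    (hz : IsSimplicialExcessOne r z) : ∃ A B, HasBlocks r z A B := by
  classical
  have hzc := hz.card_eq
  have hlt : ⊥ < z := by
    refine bot_lt_iff_ne_bot.2 ?_
    rintro rfl
    obtain ⟨a, ha⟩ := Finset.card_pos.1 (show 0 < (vertexSet r (⊥ : X)).card by omega)
    rw [mem_vertexSet] at ha
    have := h.strictMono.monotone ha.2
    have := h.bot
    omega
  have hvz : ∀ a ∈ vertexSet r z, a < z := by
    intro a ha
    rw [mem_vertexSet] at ha
    refine lt_of_le_of_ne ha.2 ?_
    rintro rfl
    rw [h.vertexSet_eq_singleton ha.1, Finset.card_singleton] at hzc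
    omega
  obtain ⟨a₀, b₀, hab, -, -⟩ := h.exists_isMissingPair hz hlt
  have hirr : ∀ x, ¬ IsMissingPair r z x x := fun x hx => hx.2.2.1 rfl
  -- Complete bipartiteness: a pair is omitted exactly when its two colours differ. Every case with
  -- distinct vertices other than `b₀` follows from the triple lemma.
  have key : ∀ x ∈ vertexSet r z, ∀ y ∈ vertexSet r z,
      IsMissingPair r z x y ↔ ¬ (IsMissingPair r z x b₀ ↔ IsMissingPair r z y b₀) := by
    intro x hx y hy
    by_cases hxy : x = y
    · subst hxy
      simp [hirr]
    by_cases h1 : IsMissingPair r z x b₀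
    · by_cases hyb : y = b₀
      · subst hyb
        simp [h1, hirr]
      · have := h.isMissingPair_triple hz h1 hy (Ne.symm hxy) hyb
        rw [this]
        simp only [h1, true_iff]
        exact not_congr ⟨fun h => h.symm, fun h => h.symm⟩
    · by_cases hxb : x = b₀
      · subst hxb
        simp only [hirr, false_iff, not_not]
        exact ⟨fun h => h.symm, fun h => h.symm⟩
      by_cases h2 : IsMissingPair r z y b₀
      · simp only [h1, h2, not_false_eq_true, iff_true]
        have := h.isMissingPair_triple hz h2 hx hxy hxb
        have h3 : ¬ IsMissingPair r z b₀ x := fun h => h1 h.symm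
        exact (this.2 h3).symm
      · simp only [h1, h2, not_true_eq_false, iff_false]
        intro hxy'
        have hyb : y ≠ b₀ := by
          rintro rfl
          exact h1 hxy'
        have := h.isMissingPair_triple hz hxy' hab.2.1 (Ne.symm hxb) (Ne.symm hyb)
        tauto
  refine ⟨{x ∈ vertexSet r z | IsMissingPair r z x b₀},
    {x ∈ vertexSet r z | ¬ IsMissingPair r z x b₀}, Finset.filter_subset _ _,
    Finset.filter_subset _ _, Finset.disjoint_filter_filter_not _ _ _, ?_⟩
  -- A proper face avoids some omitted pair, which has one vertex in each block.
  have hproper : ∀ s : Finset X, (∃ x < z, vertexSet r x = s) →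
      ¬ {x ∈ vertexSet r z | IsMissingPair r z x b₀} ⊆ s ∧
      ¬ {x ∈ vertexSet r z | ¬ IsMissingPair r z x b₀} ⊆ s := by
    rintro s ⟨x, hxz, rfl⟩
    obtain ⟨a, b, h1, h2, h3⟩ := h.exists_isMissingPair hz hxz
    have h4 := (key a h1.1 b h1.2.1).1 h1
    by_cases h5 : IsMissingPair r z a b₀
    · have h6 : ¬ IsMissingPair r z b b₀ := by tauto
      exact ⟨fun hs => h2 (hs (Finset.mem_filter.2 ⟨h1.1, h5⟩)),
        fun hs => h3 (hs (Finset.mem_filter.2 ⟨h1.2.1, h6⟩))⟩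
    · have h6 : IsMissingPair r z b b₀ := by tauto
      exact ⟨fun hs => h3 (hs (Finset.mem_filter.2 ⟨h1.2.1, h6⟩)),
        fun hs => h2 (hs (Finset.mem_filter.2 ⟨h1.1, h5⟩))⟩
  -- A block with a single vertex would be contained in a proper face, namely that vertex.
  have hcard : ∀ (A : Finset X) (a : X), a ∈ A → a ∈ vertexSet r z →
      (∀ s : Finset X, (∃ x < z, vertexSet r x = s) → ¬ A ⊆ s) → 2 ≤ A.card := by
    intro A a ha haz hA
    by_contra hcon
    have h1 : A = {a} := Finset.eq_singleton_iff_unique_mem.2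
      ⟨ha, fun b hb => Finset.card_le_one.1 (by omega) b hb a ha⟩
    exact hA {a} ⟨a, hvz a haz, h.vertexSet_eq_singleton (mem_vertexSet.1 haz).1⟩ h1.subset
  refine ⟨hcard _ a₀ (Finset.mem_filter.2 ⟨hab.1, hab⟩) hab.1 fun s hs => (hproper s hs).1,
    hcard _ b₀ (Finset.mem_filter.2 ⟨hab.2.1, hirr _⟩) hab.2.1 fun s hs => (hproper s hs).2, ?_⟩
  intro s hs
  constructor
  · rintro ⟨x, rfl⟩
    rcases (h.le_of_vertexSet_subset hs).eq_or_lt with rfl | hxz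
    · simp [Finset.filter_subset]
    · have := hproper _ ⟨x, hxz, rfl⟩
      tauto
  · intro hiff
    by_cases hA : {x ∈ vertexSet r z | IsMissingPair r z x b₀} ⊆ s
    · refine ⟨z, Finset.Subset.antisymm (fun x hx => ?_) hs⟩
      by_cases h5 : IsMissingPair r z x b₀
      · exact hA (Finset.mem_filter.2 ⟨hx, h5⟩)
      · exact hiff.1 hA (Finset.mem_filter.2 ⟨hx, h5⟩)
    · have hB := fun hB => hA (hiff.2 hB)
      obtain ⟨a, ha, has⟩ := Finset.not_subset.1 hA
      obtain ⟨b, hb, hbs⟩ := Finset.not_subset.1 hB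
      rw [Finset.mem_filter] at ha hb
      refine h.exists_vertexSet_eq_of_isMissingPair hz ((key a ha.1 b hb.1).2 ?_) hs has hbs
      tauto

/-- A facet that is not a simplex has excess one by monotonicity, so it misses a single vertex `a`
of `z`. The blocks of this facet serve for the pyramid `z`, and `a` belongs to neither. -/
theorem IsGraded.exists_hasBlocks (h : IsGraded X r)
    (hz : (vertexSet r z).card = r z + 1) : ∃ A B, HasBlocks r z A B := by
  induction z using WellFoundedLT.induction with
  | _ z ih =>
    by_cases hsimp : ∀ F, F < z → r F + 1 = r z → (vertexSet r F).card = r F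
    · exact h.hasBlocks_of_isSimplicialExcessOne ⟨hz, hsimp⟩
    push Not at hsimp
    obtain ⟨F, hF, hFr, hFc⟩ := hsimp
    have hFc' : (vertexSet r F).card = r F + 1 := by
      have := h.card_vertexSet_add_le hF.le
      have := h.rank_le_card_vertexSet F
      omega
    obtain ⟨A, B, hA, hB, hdisj, hA2, hB2, hAB⟩ := ih F hF hFc'
    have hsub := vertexSet_mono (r := r) hF.le
    have hcard := Finset.card_sdiff_add_card_eq_card hsub
    obtain ⟨a, ha⟩ := Finset.card_eq_one.1
      (show (vertexSet r z \ vertexSet r F).card = 1 by omega)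
    have ha' : a ∈ vertexSet r z \ vertexSet r F := ha ▸ Finset.mem_singleton_self a
    rw [Finset.mem_sdiff] at ha'
    have hins : vertexSet r z = insert a (vertexSet r F) := by
      rw [← Finset.sdiff_union_of_subset hsub, ha]
      rfl
    refine ⟨A, B, hA.trans hsub, hB.trans hsub, hdisj, hA2, hB2, fun s hs => ?_⟩
    have haA : a ∉ A := fun h => ha'.2 (hA h)
    have haB : a ∉ B := fun h => ha'.2 (hB h)
    have hsF : s.erase a ⊆ vertexSet r F := by
      intro c hc
      rw [Finset.mem_erase] at hc
      rcases Finset.mem_insert.1 (hins ▸ hs hc.2) with h1 | h1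
      · exact absurd h1 hc.1
      · exact h1
    have hiff := hAB (s.erase a) hsF
    -- Since `a` is outside both blocks, it remains to see that `s` is a face exactly when `s.erase
    -- a` is: meet with the base in one direction, add the apex if necessary in the other.
    simp only [Finset.subset_erase, haA, haB, not_false_eq_true, and_true] at hiff
    rw [← hiff]
    constructor
    · rintro ⟨x, rfl⟩
      refine ⟨x ⊓ F, ?_⟩
      ext c
      rw [mem_vertexSet_inf, Finset.mem_erase]
      constructor
      · rintro ⟨h1, h2⟩
        refine ⟨?_, h1⟩
        rintro rfl
        exact ha'.2 h2
      · rintro ⟨h1, h2⟩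
        exact ⟨h2, hsF (Finset.mem_erase.2 ⟨h1, h2⟩)⟩
    · rintro ⟨x, hx⟩
      by_cases has : a ∈ s
      · obtain ⟨y, hy⟩ := h.exists_vertexSet_eq_insert hF hFr ha'.2 hins
          (h.le_of_vertexSet_subset (hx ▸ hsF))
        exact ⟨y, by rw [hy, hx, Finset.insert_erase has]⟩
      · exact ⟨x, by rw [hx, Finset.erase_eq_of_notMem has]⟩

end Blocks

/-! ### From blocks to the standard lattices -/

/-- The product of the join of two simplices with a third one, as a lattice of sets. -/
abbrev SimplexJoinProd (a b m : ℕ) : Type :=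
  Join (Finset (Fin a)) (Finset (Fin b)) × Finset (Fin m)

/-- A poset of triples of sets is isomorphic to `SimplexJoinProd a b m` when it consists of the
triples the first two members of which are both full or both not full. -/
theorem nonempty_orderIso_simplexJoinProd {P : Type u} [PartialOrder P] {a b m : ℕ}
    (f : P → Finset (Fin a) × Finset (Fin b) × Finset (Fin m))
    (hle : ∀ x y, x ≤ y ↔ f x ≤ f y)
    (hf : ∀ t, (∃ x, f x = t) ↔ (t.1 = ⊤ ↔ t.2.1 = ⊤)) :
    Nonempty (P ≃o SimplexJoinProd a b m) := by
  have hmem : ∀ x, ((f x).1 < ⊤ ∧ (f x).2.1 < ⊤) ∨ ((f x).1 = ⊤ ∧ (f x).2.1 = ⊤) := by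
    intro x
    have := (hf (f x)).1 ⟨x, rfl⟩
    rw [lt_top_iff_ne_top, lt_top_iff_ne_top]
    tauto
  let g : P ↪o SimplexJoinProd a b m := OrderEmbedding.ofMapLEIff
    (fun x => (⟨((f x).1, (f x).2.1), hmem x⟩, (f x).2.2)) (fun x y => by
      rw [hle]
      exact and_assoc)
  refine ⟨RelIso.ofSurjective g ?_⟩
  rintro ⟨⟨⟨s, t⟩, hst⟩, w⟩
  obtain ⟨x, hx⟩ := (hf (s, t, w)).2 (by
    rw [lt_top_iff_ne_top, lt_top_iff_ne_top] at hst
    simp only at hst ⊢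
    tauto)
  refine ⟨x, Prod.ext (Subtype.ext ?_) ?_⟩
  · change ((f x).1, (f x).2.1) = (s, t)
    rw [hx]
  · change (f x).2.2 = w
    rw [hx]

/-- The trace of a finite set on `A`, after numbering the elements of `A`. -/
noncomputable def traceOn {α : Type*} [DecidableEq α] (A s : Finset α) : Finset (Fin A.card) :=
  {i | (A.equivFin.symm i : α) ∈ s}

theorem mem_traceOn {α : Type*} [DecidableEq α] {A s : Finset α} {i : Fin A.card} :
    i ∈ traceOn A s ↔ (A.equivFin.symm i : α) ∈ s := by
  simp [traceOn]

theorem traceOn_le_iff {α : Type*} [DecidableEq α] {A s t : Finset α} :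
    traceOn A s ≤ traceOn A t ↔ ∀ c ∈ A, c ∈ s → c ∈ t := by
  constructor
  · intro h c hc hs
    have := @h (A.equivFin ⟨c, hc⟩)
    simp only [mem_traceOn, Equiv.symm_apply_apply] at this
    exact this hs
  · intro h i
    rw [mem_traceOn, mem_traceOn]
    exact h _ (A.equivFin.symm i).2

theorem traceOn_eq_top_iff {α : Type*} [DecidableEq α] {A s : Finset α} :
    traceOn A s = ⊤ ↔ A ⊆ s := by
  rw [← top_le_iff]
  constructor
  · intro h c hc
    have := @h (A.equivFin ⟨c, hc⟩) (Finset.mem_univ _)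
    simpa [mem_traceOn] using this
  · intro h i _
    rw [mem_traceOn]
    exact h (A.equivFin.symm i).2

theorem exists_traceOn_eq {α : Type*} [DecidableEq α] {A : Finset α} (w : Finset (Fin A.card)) :
    ∃ s ⊆ A, traceOn A s = w := by
  refine ⟨w.image fun i => (A.equivFin.symm i : α), ?_, ?_⟩
  · intro c hc
    obtain ⟨i, -, rfl⟩ := Finset.mem_image.1 hc
    exact (A.equivFin.symm i).2
  · ext i
    rw [mem_traceOn, Finset.mem_image]
    constructor
    · rintro ⟨j, hj, hji⟩
      rwa [← A.equivFin.symm.injective (Subtype.ext hji)]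
    · exact fun hi => ⟨i, hi, rfl⟩

theorem traceOn_congr {α : Type*} [DecidableEq α] {A s t : Finset α}
    (h : ∀ c ∈ A, c ∈ s ↔ c ∈ t) : traceOn A s = traceOn A t :=
  le_antisymm (traceOn_le_iff.2 fun c hc => (h c hc).1) (traceOn_le_iff.2 fun c hc => (h c hc).2)

section

variable {X : Type u} [Lattice X] [BoundedOrder X] [Fintype X] [DecidableEq X] {r : X → ℕ}

omit [BoundedOrder X] [DecidableEq X] in
theorem HasBlocks.symm {z : X} {A B : Finset X} (h : HasBlocks r z A B) : HasBlocks r z B A := by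
  obtain ⟨h1, h2, h3, h4, h5, h6⟩ := h
  exact ⟨h2, h1, h3.symm, h5, h4, fun s hs => (h6 s hs).trans Iff.comm⟩

/-- A vertex set is recorded by its traces on `A`, `B` and the remaining vertices `C`. The face
condition constrains only the first two traces, so `C` contributes a full Boolean lattice. -/
theorem HasBlocks.nonempty_orderIso (h : IsGraded X r) {A B : Finset X}
    (hAB : HasBlocks r ⊤ A B) :
    Nonempty (X ≃o SimplexJoinProd A.card B.card (vertexSet r ⊤ \ (A ∪ B)).card) := by
  obtain ⟨hA, hB, hdisj, -, -, hs⟩ := hAB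
  set C := vertexSet r (⊤ : X) \ (A ∪ B) with hC
  have hcover : ∀ c ∈ vertexSet r (⊤ : X), c ∈ A ∨ c ∈ B ∨ c ∈ C := by
    intro c hc
    rw [hC, Finset.mem_sdiff, Finset.mem_union]
    tauto
  have hAC : ∀ c, c ∈ C → c ∉ A ∧ c ∉ B := by
    intro c hc
    rw [hC, Finset.mem_sdiff, Finset.mem_union] at hc
    tauto
  have hABd : ∀ c ∈ A, c ∉ B := fun _ hc => Finset.disjoint_left.1 hdisj hc
  refine nonempty_orderIso_simplexJoinProd
    (fun x => (traceOn A (vertexSet r x), traceOn B (vertexSet r x), traceOn C (vertexSet r x)))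
    ?_ ?_
  · intro x y
    rw [← h.vertexSet_subset_iff, Prod.mk_le_mk, Prod.mk_le_mk, traceOn_le_iff, traceOn_le_iff,
      traceOn_le_iff]
    constructor
    · exact fun hxy => ⟨fun c _ hc => hxy hc, fun c _ hc => hxy hc, fun c _ hc => hxy hc⟩
    · rintro ⟨h1, h2, h3⟩ c hc
      rcases hcover c (vertexSet_mono le_top hc) with h4 | h4 | h4
      · exact h1 c h4 hc
      · exact h2 c h4 hc
      · exact h3 c h4 hc
  · rintro ⟨t₁, t₂, t₃⟩
    constructor
    · rintro ⟨x, hx⟩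
      simp only [Prod.mk.injEq] at hx
      rw [← hx.1, ← hx.2.1, traceOn_eq_top_iff, traceOn_eq_top_iff]
      exact (hs _ (vertexSet_mono le_top)).1 ⟨x, rfl⟩
    · intro ht
      obtain ⟨s₁, hs₁, rfl⟩ := exists_traceOn_eq t₁
      obtain ⟨s₂, hs₂, rfl⟩ := exists_traceOn_eq t₂
      obtain ⟨s₃, hs₃, rfl⟩ := exists_traceOn_eq t₃
      have e1 : traceOn A (s₁ ∪ s₂ ∪ s₃) = traceOn A s₁ := traceOn_congr fun c hc => by
        have h1 := hABd c hc
        have h2 := hAC c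
        have h3 := @hs₂ c
        have h4 := @hs₃ c
        simp only [Finset.mem_union]
        tauto
      have e2 : traceOn B (s₁ ∪ s₂ ∪ s₃) = traceOn B s₂ := traceOn_congr fun c hc => by
        have h1 := hABd c
        have h2 := hAC c
        have h3 := @hs₁ c
        have h4 := @hs₃ c
        simp only [Finset.mem_union]
        tauto
      have e3 : traceOn C (s₁ ∪ s₂ ∪ s₃) = traceOn C s₃ := traceOn_congr fun c hc => by
        have h2 := hAC c hc
        have h3 := @hs₁ c
        have h4 := @hs₂ c
        simp only [Finset.mem_union]
        tauto
      obtain ⟨x, hx⟩ := (hs (s₁ ∪ s₂ ∪ s₃) (Finset.union_subset (Finset.union_subset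
        (hs₁.trans hA) (hs₂.trans hB)) (hs₃.trans Finset.sdiff_subset))).2 (by
          rw [← traceOn_eq_top_iff, ← traceOn_eq_top_iff, e1, e2]
          exact ht)
      exact ⟨x, by simp only [hx, e1, e2, e3]⟩

end

/-- The classification of the cellular pseudomanifolds of excess one. -/
theorem IsCellularPseudomanifold.exists_orderIso_simplexJoinProd {X : Type u} [Lattice X]
    [BoundedOrder X] (h : IsCellularPseudomanifold X) (he : excess X = 1) :
    ∃ a b m : ℕ, 2 ≤ a ∧ a ≤ b ∧ (a + b + m : ℤ) = dim X + 3 ∧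
      Nonempty (X ≃o SimplexJoinProd a b m) := by
  classical
  have := h.finite
  let _ := Fintype.ofFinite X
  have hg := h.isGraded
  have hn : numVertices X = (vertexSet rank (⊤ : X)).card := by
    rw [numVertices, ← Set.ncard_coe_finset]
    congr 1
    ext x
    simp [mem_vertexSet]
  have hz : (vertexSet rank (⊤ : X)).card = rank (⊤ : X) + 1 := by
    rw [← hn]
    unfold excess dim at he
    omega
  suffices ∃ A B : Finset X, HasBlocks rank ⊤ A B ∧ A.card ≤ B.card by
    obtain ⟨A, B, hAB, hle⟩ := this
    refine ⟨_, _, _, hAB.2.2.2.1, hle, ?_, hAB.nonempty_orderIso hg⟩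
    obtain ⟨hA, hB, hdisj, -⟩ := hAB
    have h1 := Finset.card_sdiff_add_card_eq_card (Finset.union_subset hA hB)
    rw [Finset.card_union_of_disjoint hdisj] at h1
    unfold dim
    omega
  obtain ⟨A, B, hAB⟩ := hg.exists_hasBlocks hz
  rcases le_total A.card B.card with h1 | h1
  · exact ⟨A, B, hAB, h1⟩
  · exact ⟨B, A, hAB.symm, h1⟩

/-! ### Direct products -/

section Prod

variable {X : Type u} {Y : Type v} [Lattice X] [BoundedOrder X] [Lattice Y] [BoundedOrder Y]
  {r : X → ℕ} {q : Y → ℕ}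

theorem IsGraded.eq_or_eq (h : IsGraded X r) {x y z : X} (hxy : x ≤ y) (hyz : y ≤ z)
    (hr : r z = r x + 1) : y = x ∨ y = z := by
  have h1 := h.strictMono.monotone hxy
  rcases Nat.lt_or_ge (r x) (r y) with h2 | h2
  · exact Or.inr (h.eq_of_le hyz (by omega))
  · exact Or.inl (h.eq_of_le hxy h2).symm

theorem IsGraded.prod (hX : IsGraded X r) (hY : IsGraded Y q) :
    IsGraded (X × Y) (fun p => r p.1 + q p.2) where
  bot := by simp [hX.bot, hY.bot]
  strictMono := by
    intro p p' hp
    rcases Prod.lt_iff.1 hp with ⟨h1, h2⟩ | ⟨h1, h2⟩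
    · exact add_lt_add_of_lt_of_le (hX.strictMono h1) (hY.strictMono.monotone h2)
    · exact add_lt_add_of_le_of_lt (hX.strictMono.monotone h1) (hY.strictMono h2)
  exists_succ := by
    rintro ⟨x, y⟩ ⟨x', y'⟩ hp
    rcases Prod.lt_iff.1 hp with ⟨h1, h2⟩ | ⟨h1, h2⟩
    · obtain ⟨w, hw, hw', hr⟩ := hX.exists_succ x x' h1
      exact ⟨(w, y), Prod.lt_iff.2 (Or.inl ⟨hw, le_rfl⟩), ⟨hw', h2⟩, by simp only [hr]; ring⟩
    · obtain ⟨w, hw, hw', hr⟩ := hY.exists_succ y y' h2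
      exact ⟨(x, w), Prod.lt_iff.2 (Or.inr ⟨le_rfl, hw⟩), ⟨h1, hw'⟩, by simp only [hr]; ring⟩
  diamond := by
    rintro ⟨x, y⟩ ⟨x', y'⟩ hp hr
    have hle := hp.le
    simp only [Prod.mk_le_mk] at hle hr
    have hr1 := hX.strictMono.monotone hle.1
    have hr2 := hY.strictMono.monotone hle.2
    rcases hle.1.eq_or_lt with rfl | hx
    · have hy : y < y' := by simpa using hp
      obtain ⟨w₁, w₂, hne, hw⟩ := hY.diamond y y' hy (by omega)
      refine ⟨(x, w₁), (x, w₂), by simpa using hne, ?_⟩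
      rintro ⟨s, t⟩
      simp only [Prod.mk.injEq]
      constructor
      · rintro ⟨h1, h2⟩
        have hs : s = x := le_antisymm h2.le.1 h1.le.1
        subst hs
        simpa [← hw] using And.intro h1 h2
      · intro h
        have hs : s = x := by tauto
        subst hs
        simpa [hw] using h
    rcases hle.2.eq_or_lt with rfl | hy
    · obtain ⟨w₁, w₂, hne, hw⟩ := hX.diamond x x' hx (by omega)
      refine ⟨(w₁, y), (w₂, y), by simpa using hne, ?_⟩
      rintro ⟨s, t⟩
      simp only [Prod.mk.injEq]
      constructor
      · rintro ⟨h1, h2⟩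
        have hs : t = y := le_antisymm h2.le.2 h1.le.2
        subst hs
        simpa [← hw] using And.intro h1 h2
      · intro h
        have hs : t = y := by tauto
        subst hs
        simpa [hw] using h
    -- Both coordinates rise by one, and the two intermediate elements are the mixed corners of the
    -- square.
    · have hx' := hX.strictMono hx
      have hy' := hY.strictMono hy
      refine ⟨(x, y'), (x', y), by simp [hx.ne], ?_⟩
      rintro ⟨s, t⟩
      constructor
      · rintro ⟨h1, h2⟩
        rcases hX.eq_or_eq h1.le.1 h2.le.1 (by simp only; omega) with h3 | h3 <;>
          rcases hY.eq_or_eq h1.le.2 h2.le.2 (by simp only; omega) with h4 | h4 <;>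
          simp only at h3 h4 <;> subst h3 <;> subst h4
        · exact absurd h1 (lt_irrefl _)
        · exact Or.inl rfl
        · exact Or.inr rfl
        · exact absurd h2 (lt_irrefl _)
      · rintro (h | h) <;> rw [h]
        · exact ⟨Prod.lt_iff.2 (Or.inr ⟨le_rfl, hy⟩), Prod.lt_iff.2 (Or.inl ⟨hx, le_rfl⟩)⟩
        · exact ⟨Prod.lt_iff.2 (Or.inl ⟨hx, le_rfl⟩), Prod.lt_iff.2 (Or.inr ⟨le_rfl, hy⟩)⟩

omit [BoundedOrder X] [BoundedOrder Y] in
theorem AdjOrEq.prod_left {z σ τ : X} (h : AdjOrEq r z σ τ) (w : Y) :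
    AdjOrEq (fun p : X × Y => r p.1 + q p.2) (z, w) (σ, w) (τ, w) := by
  rcases h with rfl | h
  · exact Or.inl rfl
  · refine Or.inr ?_
    simp only [Prod.mk_inf_mk, inf_idem]
    omega

omit [BoundedOrder X] [BoundedOrder Y] in
theorem AdjOrEq.prod_right {w σ τ : Y} (h : AdjOrEq q w σ τ) (z : X) :
    AdjOrEq (fun p : X × Y => r p.1 + q p.2) (z, w) (z, σ) (z, τ) := by
  rcases h with rfl | h
  · exact Or.inl rfl
  · refine Or.inr ?_
    simp only [Prod.mk_inf_mk, inf_idem]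
    omega

omit [BoundedOrder X] in
theorem AdjOrEq.symm {z σ τ : X} (h : AdjOrEq r z σ τ) : AdjOrEq r z τ σ := by
  rcases h with rfl | h
  · exact Or.inl rfl
  · exact Or.inr (by rwa [inf_comm])

omit [BoundedOrder X] [BoundedOrder Y] in
theorem adjOrEq_prod_of_facets {z σ : X} {w τ : Y} (hσ : σ ≤ z) (hτ : τ ≤ w)
    (h1 : r σ + 1 = r z) (h2 : q τ + 1 = q w) :
    AdjOrEq (fun p : X × Y => r p.1 + q p.2) (z, w) (σ, w) (z, τ) := by
  refine Or.inr ?_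
  simp only [Prod.mk_inf_mk, inf_eq_left.2 hσ, inf_eq_right.2 hτ]
  omega

theorem IsGraded.prod_facet (hX : IsGraded X r) (hY : IsGraded Y q) {σ z : X} {τ w : Y}
    (hσ : σ ≤ z) (hτ : τ ≤ w) (h : r σ + q τ + 1 = r z + q w) :
    (r σ + 1 = r z ∧ τ = w) ∨ (σ = z ∧ q τ + 1 = q w) := by
  have h1 := hX.strictMono.monotone hσ
  have h2 := hY.strictMono.monotone hτ
  rcases Nat.lt_or_ge (r σ) (r z) with h3 | h3
  · exact Or.inl ⟨by omega, hY.eq_of_le hτ (by omega)⟩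
  · exact Or.inr ⟨hX.eq_of_le hσ h3, by omega⟩

/-- A facet lowers one coordinate by one rank. Two facets lowering the same coordinate are compared
in that factor; if the coordinates differ, their meet lowers both and has corank two. -/
theorem HasAdjacentFacets.prod (hX : IsGraded X r) (hY : IsGraded Y q)
    (hX' : HasAdjacentFacets X r) (hY' : HasAdjacentFacets Y q) :
    HasAdjacentFacets (X × Y) (fun p => r p.1 + q p.2) := by
  rintro ⟨z, w⟩ ⟨σ, τ⟩ ⟨σ', τ'⟩ h1 h2 h3 h4
  rw [Prod.mk_le_mk] at h1 h2
  rcases hX.prod_facet hY h1.1 h1.2 h3 with ⟨h5, rfl⟩ | ⟨rfl, h5⟩ <;>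
    rcases hX.prod_facet hY h2.1 h2.2 h4 with ⟨h6, rfl⟩ | ⟨rfl, h6⟩
  · exact (hX' _ _ _ h1.1 h2.1 h5 h6).prod_left _
  · exact adjOrEq_prod_of_facets h1.1 h2.2 h5 h6
  · exact (adjOrEq_prod_of_facets h2.1 h1.2 h6 h5).symm
  · exact (hY' _ _ _ h1.2 h2.2 h5 h6).prod_right _

theorem HasFacetDiameterTwo.prod (hX : IsGraded X r) (hY : IsGraded Y q)
    (hX' : HasFacetDiameterTwo X r) (hY' : HasFacetDiameterTwo Y q) :
    HasFacetDiameterTwo (X × Y) (fun p => r p.1 + q p.2) := by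
  rintro ⟨x, y⟩ ⟨z, w⟩ ⟨σ, τ⟩ ⟨σ', τ'⟩ g1 g2 h1 h2 h3 h4
  have g1' := g1
  have g2' := g2
  have h1' := h1
  have h3' := h3
  rw [Prod.mk_le_mk] at h1 h2 g1 g2
  rcases hX.prod_facet hY h1.1 h1.2 h3 with ⟨h5, rfl⟩ | ⟨rfl, h5⟩ <;>
    rcases hX.prod_facet hY h2.1 h2.2 h4 with ⟨h6, rfl⟩ | ⟨rfl, h6⟩
  · obtain ⟨ρ, k1, k2, k3, k4, k5⟩ := hX' _ _ _ _ g1.1 g2.1 h1.1 h2.1 h5 h6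
    exact ⟨(ρ, _), ⟨k1, g1.2⟩, ⟨k2, le_rfl⟩, by simp only; omega, k4.prod_left _, k5.prod_left _⟩
  · exact ⟨_, g1', h1', h3', Or.inl rfl, adjOrEq_prod_of_facets h1.1 h2.2 h5 h6⟩
  · exact ⟨_, g1', h1', h3', Or.inl rfl, (adjOrEq_prod_of_facets h2.1 h1.2 h6 h5).symm⟩
  · obtain ⟨ρ, k1, k2, k3, k4, k5⟩ := hY' _ _ _ _ g1.2 g2.2 h1.2 h2.2 h5 h6
    exact ⟨(_, ρ), ⟨g1.1, k1⟩, ⟨le_rfl, k2⟩, by simp only; omega, k4.prod_right _,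
      k5.prod_right _⟩

theorem IsGraded.eq_bot_iff (h : IsGraded X r) {x : X} : r x = 0 ↔ x = ⊥ := by
  constructor
  · intro hx
    exact (h.eq_of_le bot_le (by omega)).symm
  · rintro rfl
    exact h.bot

theorem IsGraded.ncard_prod [Finite X] [Finite Y] (hX : IsGraded X r) (hY : IsGraded Y q) :
    {p : X × Y | r p.1 + q p.2 = 1}.ncard = {x | r x = 1}.ncard + {y | q y = 1}.ncard := by
  have hx := Set.ncard_image_of_injective {x : X | r x = 1} (Prod.mk_left_injective (⊥ : Y))
  have hy := Set.ncard_image_of_injective {y : Y | q y = 1} (Prod.mk_right_injective (⊥ : X))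
  rw [← hx, ← hy, ← Set.ncard_union_eq]
  · congr 1
    ext ⟨x, y⟩
    simp only [Set.mem_ofPred_eq, Set.mem_union, Set.mem_image, Prod.mk.injEq]
    constructor
    · intro h
      rcases Nat.eq_zero_or_pos (r x) with h1 | h1
      · exact Or.inr ⟨y, by omega, (hX.eq_bot_iff.1 h1).symm, rfl⟩
      · exact Or.inl ⟨x, by omega, rfl, (hY.eq_bot_iff.1 (by omega)).symm⟩
    · rintro (⟨x, h, rfl, rfl⟩ | ⟨y, h, rfl, rfl⟩)
      · rw [h, hY.bot]
      · rw [h, hX.bot]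
  · rw [Set.disjoint_left]
    rintro _ ⟨x, hx, rfl⟩ ⟨y, hy, he⟩
    rw [Prod.mk.injEq] at he
    rw [Set.mem_ofPred_eq, ← he.1, hX.bot] at hx
    omega

end Prod

/-! ### Joins -/

section Join

variable {X : Type u} {Y : Type v} [Lattice X] [BoundedOrder X] [Lattice Y] [BoundedOrder Y]
  {r : X → ℕ} {q : Y → ℕ}

/-- The underlying pair of a member of a join. -/
def Join.toProd (p : Join X Y) : X × Y := p.1

/-- The member of the join with the given entries below the top. -/
def Join.mk (w : X × Y) (h : w.1 < ⊤ ∧ w.2 < ⊤) : Join X Y := ⟨w, Or.inl h⟩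

@[simp] theorem Join.toProd_mk (w : X × Y) (h : w.1 < ⊤ ∧ w.2 < ⊤) :
    (Join.mk w h).toProd = w := rfl

theorem Join.toProd_injective : Function.Injective (Join.toProd : Join X Y → X × Y) :=
  Subtype.val_injective

theorem Join.ext {p p' : Join X Y} (h : p.toProd = p'.toProd) : p = p' := Subtype.ext h

open Classical in
/-- The rank function of a join. -/
noncomputable def joinRank (r : X → ℕ) (q : Y → ℕ) (p : Join X Y) : ℕ :=
  if p = ⊤ then r ⊤ + q ⊤ - 1 else r p.toProd.1 + q p.toProd.2

theorem joinRank_top : joinRank r q ⊤ = r ⊤ + q ⊤ - 1 := if_pos rfl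

theorem joinRank_of_ne {p : Join X Y} (h : p ≠ ⊤) : joinRank r q p = r p.toProd.1 + q p.toProd.2 :=
  if_neg h

theorem Join.lt_top_of_ne {p : Join X Y} (h : p ≠ ⊤) : p.toProd.1 < ⊤ ∧ p.toProd.2 < ⊤ := by
  rcases p.2 with h1 | h1
  · exact h1
  · exact absurd (Join.ext (p' := ⊤) (Prod.ext h1.1 h1.2)) h

theorem Join.mk_ne_top {w : X × Y} (h : w.1 < ⊤ ∧ w.2 < ⊤) : Join.mk w h ≠ ⊤ :=
  fun he => h.1.ne (congrArg (fun p : Join X Y => p.toProd.1) he)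

theorem Join.ne_top_of_le {p p' : Join X Y} (h : p ≤ p') (h' : p' ≠ ⊤) : p ≠ ⊤ := by
  rintro rfl
  exact h' (top_le_iff.1 h)

theorem Join.bot_eq (hX : (⊥ : X) < ⊤) (hY : (⊥ : Y) < ⊤) :
    (⊥ : Join X Y) = Join.mk (⊥, ⊥) ⟨hX, hY⟩ :=
  le_antisymm bot_le (show ((⊥, ⊥) : X × Y) ≤ (⊥ : Join X Y).toProd from bot_le)

/-- Below the top, everything is inherited from the product. The top lies directly above the pairs
of coatoms, hence has rank one less than in the product. -/
theorem IsGraded.join (hX : IsGraded X r) (hY : IsGraded Y q) (hX0 : (⊥ : X) < ⊤)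
    (hY0 : (⊥ : Y) < ⊤) : IsGraded (Join X Y) (joinRank r q) where
  bot := by
    rw [Join.bot_eq hX0 hY0, joinRank_of_ne (Join.mk_ne_top ⟨hX0, hY0⟩)]
    simp [hX.bot, hY.bot]
  strictMono := by
    intro p p' hp
    have hpt : p ≠ ⊤ := (hp.trans_le le_top).ne
    rw [joinRank_of_ne hpt]
    by_cases hp' : p' = ⊤
    · rw [hp', joinRank_top]
      have h1 := hX.strictMono (Join.lt_top_of_ne hpt).1
      have h2 := hY.strictMono (Join.lt_top_of_ne hpt).2
      omega
    · rw [joinRank_of_ne hp']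
      exact (hX.prod hY).strictMono hp
  exists_succ := by
    intro p p' hp
    have hpt : p ≠ ⊤ := (hp.trans_le le_top).ne
    by_cases hp' : p' = ⊤
    · subst hp'
      have h0 := Join.lt_top_of_ne hpt
      obtain ⟨s, hs, -, hsr⟩ := hX.exists_succ _ _ h0.1
      obtain ⟨t, ht, -, htr⟩ := hY.exists_succ _ _ h0.2
      by_cases hst : s = ⊤
      · by_cases htt : t = ⊤
        · refine ⟨⊤, hp, le_rfl, ?_⟩
          rw [hst] at hsr
          rw [htt] at htr
          rw [joinRank_top, joinRank_of_ne hpt]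
          omega
        · have hw0 : (p.toProd.1, t).1 < ⊤ ∧ (p.toProd.1, t).2 < ⊤ :=
            ⟨h0.1, lt_top_iff_ne_top.2 htt⟩
          refine ⟨Join.mk (p.toProd.1, t) hw0,
            Prod.lt_iff.2 (Or.inr ⟨le_rfl, ht⟩), le_top, ?_⟩
          rw [joinRank_of_ne (Join.mk_ne_top hw0), joinRank_of_ne hpt, Join.toProd_mk, htr]
          ring
      · have hw0 : (s, p.toProd.2).1 < ⊤ ∧ (s, p.toProd.2).2 < ⊤ :=
          ⟨lt_top_iff_ne_top.2 hst, h0.2⟩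
        refine ⟨Join.mk (s, p.toProd.2) hw0,
          Prod.lt_iff.2 (Or.inl ⟨hs, le_rfl⟩), le_top, ?_⟩
        rw [joinRank_of_ne (Join.mk_ne_top hw0), joinRank_of_ne hpt, Join.toProd_mk, hsr]
        ring
    · obtain ⟨w, hw, hw', hr⟩ := (hX.prod hY).exists_succ p.toProd p'.toProd hp
      have h0 := Join.lt_top_of_ne hp'
      have hw0 : w.1 < ⊤ ∧ w.2 < ⊤ := ⟨hw'.1.trans_lt h0.1, hw'.2.trans_lt h0.2⟩
      refine ⟨Join.mk w hw0, hw, hw', ?_⟩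
      rw [joinRank_of_ne hpt, joinRank_of_ne (Join.mk_ne_top hw0), Join.toProd_mk, hr]
  diamond := by
    intro p p' hp hr
    have hpt : p ≠ ⊤ := (hp.trans_le le_top).ne
    have h0 := Join.lt_top_of_ne hpt
    rw [joinRank_of_ne hpt] at hr
    by_cases hp' : p' = ⊤
    · subst hp'
      rw [joinRank_top] at hr
      have hr1 := hX.strictMono h0.1
      have hr2 := hY.strictMono h0.2
      -- The coranks of the two entries are positive and add up to three: one entry is a coatom and
      -- must stay fixed, while the other has corank two and supplies the diamond.
      rcases Nat.lt_or_ge (r p.toProd.1 + 1) (r ⊤) with h1 | h1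
      · obtain ⟨w₁, w₂, hne, hw⟩ := hX.diamond _ _ h0.1 (by omega)
        have g1 := (hw w₁).2 (Or.inl rfl)
        have g2 := (hw w₂).2 (Or.inr rfl)
        refine ⟨Join.mk (w₁, p.toProd.2) ⟨g1.2, h0.2⟩, Join.mk (w₂, p.toProd.2) ⟨g2.2, h0.2⟩,
          fun h => hne (congrArg (fun p : Join X Y => p.toProd.1) h), fun y => ?_⟩
        constructor
        · rintro ⟨hy, hy'⟩
          have hy0 := Join.lt_top_of_ne hy'.ne
          have hy2 : y.toProd.2 = p.toProd.2 := by
            rcases hY.eq_or_eq (show p.toProd.2 ≤ y.toProd.2 from hy.le.2) le_top (by omega) with h | h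
            · exact h
            · exact absurd h hy0.2.ne
          have hy1 : p.toProd.1 < y.toProd.1 := lt_of_le_of_ne hy.le.1 fun he =>
            hy.ne (Join.ext (Prod.ext he hy2.symm))
          rcases (hw y.toProd.1).1 ⟨hy1, hy0.1⟩ with h | h
          · exact Or.inl (Join.ext (Prod.ext h hy2))
          · exact Or.inr (Join.ext (Prod.ext h hy2))
        · rintro (rfl | rfl)
          · exact ⟨Prod.lt_iff.2 (Or.inl ⟨g1.1, le_rfl⟩), lt_top_iff_ne_top.2 (Join.mk_ne_top _)⟩
          · exact ⟨Prod.lt_iff.2 (Or.inl ⟨g2.1, le_rfl⟩), lt_top_iff_ne_top.2 (Join.mk_ne_top _)⟩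
      · obtain ⟨w₁, w₂, hne, hw⟩ := hY.diamond _ _ h0.2 (by omega)
        have g1 := (hw w₁).2 (Or.inl rfl)
        have g2 := (hw w₂).2 (Or.inr rfl)
        refine ⟨Join.mk (p.toProd.1, w₁) ⟨h0.1, g1.2⟩, Join.mk (p.toProd.1, w₂) ⟨h0.1, g2.2⟩,
          fun h => hne (congrArg (fun p : Join X Y => p.toProd.2) h), fun y => ?_⟩
        constructor
        · rintro ⟨hy, hy'⟩
          have hy0 := Join.lt_top_of_ne hy'.ne
          have hy2 : y.toProd.1 = p.toProd.1 := by
            rcases hX.eq_or_eq (show p.toProd.1 ≤ y.toProd.1 from hy.le.1) le_top (by omega) with h | h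
            · exact h
            · exact absurd h hy0.1.ne
          have hy1 : p.toProd.2 < y.toProd.2 := lt_of_le_of_ne hy.le.2 fun he =>
            hy.ne (Join.ext (Prod.ext hy2.symm he))
          rcases (hw y.toProd.2).1 ⟨hy1, hy0.2⟩ with h | h
          · exact Or.inl (Join.ext (Prod.ext hy2 h))
          · exact Or.inr (Join.ext (Prod.ext hy2 h))
        · rintro (rfl | rfl)
          · exact ⟨Prod.lt_iff.2 (Or.inr ⟨le_rfl, g1.1⟩), lt_top_iff_ne_top.2 (Join.mk_ne_top _)⟩
          · exact ⟨Prod.lt_iff.2 (Or.inr ⟨le_rfl, g2.1⟩), lt_top_iff_ne_top.2 (Join.mk_ne_top _)⟩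
    · rw [joinRank_of_ne hp'] at hr
      obtain ⟨w₁, w₂, hne, hw⟩ := (hX.prod hY).diamond p.toProd p'.toProd hp hr
      have h0' := Join.lt_top_of_ne hp'
      have hlt : ∀ w : X × Y, w < p'.toProd → w.1 < ⊤ ∧ w.2 < ⊤ := fun w hw =>
        ⟨hw.le.1.trans_lt h0'.1, hw.le.2.trans_lt h0'.2⟩
      refine ⟨Join.mk w₁ (hlt _ ((hw w₁).2 (Or.inl rfl)).2),
        Join.mk w₂ (hlt _ ((hw w₂).2 (Or.inr rfl)).2), fun h => hne (congrArg Join.toProd h),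
        fun y => ?_⟩
      rw [← Join.toProd_injective.eq_iff, ← Join.toProd_injective.eq_iff (a := y)]
      exact hw y.toProd

/-- Facets of the top are pairs of coatoms. If both entries differ they need not be adjacent, but
changing one entry at a time passes through a mixed pair; hence diameter two. Below the top, facets
are those of the product and are already adjacent. -/
theorem HasAdjacentFacets.join (hX : IsGraded X r) (hY : IsGraded Y q)
    (hX' : HasAdjacentFacets X r) (hY' : HasAdjacentFacets Y q) :
    HasFacetDiameterTwo (Join X Y) (joinRank r q) := by
  have hadj : ∀ {z : X × Y} {p : Join X Y} {σ τ : Join X Y}, σ ≠ ⊤ → τ ≠ ⊤ →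
      r z.1 + q z.2 = joinRank r q p → AdjOrEq (fun p : X × Y => r p.1 + q p.2) z σ.toProd τ.toProd →
      AdjOrEq (joinRank r q) p σ τ := by
    intro z p σ τ hσ hτ hz h
    rcases h with h | h
    · exact Or.inl (Join.ext h)
    · refine Or.inr ?_
      rw [joinRank_of_ne (Join.ne_top_of_le inf_le_left hσ), ← hz]
      exact h
  intro p z σ τ g1 g2 h1 h2 h3 h4
  have hσt : σ ≠ ⊤ := by
    rintro rfl
    rw [top_le_iff.1 h1] at h3
    omega
  have hτt : τ ≠ ⊤ := by
    rintro rfl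
    rw [top_le_iff.1 h2] at h4
    omega
  by_cases hz : z = ⊤
  · subst hz
    have hσ0 := Join.lt_top_of_ne hσt
    have hτ0 := Join.lt_top_of_ne hτt
    rw [joinRank_of_ne hσt, joinRank_top] at h3
    rw [joinRank_of_ne hτt, joinRank_top] at h4
    have a1 := hX.strictMono hσ0.1
    have a2 := hX.strictMono hτ0.1
    have b1 := hY.strictMono hσ0.2
    have b2 := hY.strictMono hτ0.2
    have hρ0 : σ.toProd.1 < ⊤ ∧ τ.toProd.2 < ⊤ := ⟨hσ0.1, hτ0.2⟩
    have key : ∀ {σ τ : Join X Y}, σ ≠ ⊤ → τ ≠ ⊤ → r σ.toProd.1 + q σ.toProd.2 + 2 = r ⊤ + q ⊤ →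
        (σ.toProd.1 = τ.toProd.1 ∨ AdjOrEq r ⊤ σ.toProd.1 τ.toProd.1 ∧ σ.toProd.2 = τ.toProd.2) →
        (σ.toProd.2 = τ.toProd.2 ∨ AdjOrEq q ⊤ σ.toProd.2 τ.toProd.2 ∧ σ.toProd.1 = τ.toProd.1) →
        r σ.toProd.1 + 1 = r ⊤ → q σ.toProd.2 + 1 = q ⊤ →
        AdjOrEq (joinRank r q) ⊤ σ τ := by
      intro σ τ hσ hτ hr hs ht hs1 ht1
      by_cases h : σ = τ
      · exact Or.inl h
      have hne : ¬ (σ.toProd.1 = τ.toProd.1 ∧ σ.toProd.2 = τ.toProd.2) := fun hc =>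
        h (Join.ext (Prod.ext hc.1 hc.2))
      refine Or.inr ?_
      rw [joinRank_of_ne (Join.ne_top_of_le inf_le_left hσ), joinRank_top]
      change r (σ.toProd.1 ⊓ τ.toProd.1) + q (σ.toProd.2 ⊓ τ.toProd.2) + 2 = _
      rcases hs with hs | ⟨hs, ht'⟩
      · rcases ht with ht | ⟨ht | ht, -⟩
        · exact absurd ⟨hs, ht⟩ hne
        · exact absurd ⟨hs, ht⟩ hne
        · rw [← hs, inf_idem]
          omega
      · rcases hs with hs | hs
        · exact absurd ⟨hs, ht'⟩ hne
        · rw [← ht', inf_idem]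
          omega
    refine ⟨Join.mk (σ.toProd.1, τ.toProd.2) hρ0, ⟨g1.1, g2.2⟩, le_top, ?_, ?_, ?_⟩
    · rw [joinRank_of_ne (Join.mk_ne_top hρ0), joinRank_top, Join.toProd_mk]
      dsimp only
      omega
    · exact key hσt (Join.mk_ne_top hρ0) (by omega) (Or.inl rfl)
        (Or.inr ⟨hY' _ _ _ le_top le_top (by omega) (by simp only [Join.toProd_mk]; omega), rfl⟩)
        (by omega) (by omega)
    · exact key (Join.mk_ne_top hρ0) hτt (by simp only [Join.toProd_mk]; omega)
        (Or.inr ⟨hX' _ _ _ le_top le_top (by simp only [Join.toProd_mk]; omega) (by omega), rfl⟩) (Or.inl rfl)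
        (by simp only [Join.toProd_mk]; omega) (by simp only [Join.toProd_mk]; omega)
  · have h3' := h3
    rw [joinRank_of_ne hσt, joinRank_of_ne hz] at h3
    rw [joinRank_of_ne hτt, joinRank_of_ne hz] at h4
    exact ⟨σ, g1, h1, h3', Or.inl rfl, hadj hσt hτt (joinRank_of_ne hz).symm
      (HasAdjacentFacets.prod hX hY hX' hY' z.toProd σ.toProd τ.toProd h1 h2 h3 h4)⟩

theorem IsGraded.ncard_join [Finite X] [Finite Y] (hX : IsGraded X r) (hY : IsGraded Y q)
    (hX0 : 2 ≤ r ⊤) (hY0 : 2 ≤ q ⊤) :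
    {p : Join X Y | joinRank r q p = 1}.ncard = {x | r x = 1}.ncard + {y | q y = 1}.ncard := by
  rw [← hX.ncard_prod hY, ← Set.ncard_image_of_injective {p : Join X Y | joinRank r q p = 1}
    Join.toProd_injective]
  congr 1
  ext w
  simp only [Set.mem_image, Set.mem_ofPred_eq]
  constructor
  · rintro ⟨p, hp, rfl⟩
    rwa [joinRank_of_ne] at hp
    rintro rfl
    rw [joinRank_top] at hp
    omega
  · intro hw
    -- A full entry would have rank at least two, so a vertex of the product stays in the join.
    have hw0 : w.1 < ⊤ ∧ w.2 < ⊤ := by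
      constructor <;> rw [lt_top_iff_ne_top] <;> intro h <;> rw [h] at hw <;> omega
    exact ⟨Join.mk w hw0, by rwa [joinRank_of_ne (Join.mk_ne_top hw0)], rfl⟩

end Join

/-! ### Simplices and their joins -/

section Simplex

variable {α : Type u} [Fintype α] [DecidableEq α]

theorem isGraded_finset : IsGraded (Finset α) Finset.card where
  bot := rfl
  strictMono := Finset.card_strictMono
  exists_succ s t h := by
    obtain ⟨c, hc, hcs⟩ := Finset.exists_of_ssubset h
    exact ⟨insert c s, Finset.ssubset_insert hcs, Finset.insert_subset hc h.1,
      Finset.card_insert_of_notMem hcs⟩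
  diamond s t h hr := by
    have h1 := Finset.card_sdiff_add_card_eq_card h.le
    obtain ⟨i, j, hij, hts⟩ := Finset.card_eq_two.1 (show (t \ s).card = 2 by omega)
    have hmem : ∀ c, c ∈ t ∧ c ∉ s ↔ c = i ∨ c = j := by
      intro c
      simpa using Finset.ext_iff.1 hts c
    have hi := (hmem i).2 (Or.inl rfl)
    have hj := (hmem j).2 (Or.inr rfl)
    have hst : ∀ c, c ∈ s → c ∈ t := fun c hc => h.le hc
    refine ⟨insert i s, insert j s, ?_, ?_⟩
    · intro he
      have := Finset.ext_iff.1 he i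
      simp [hij, hi.2] at this
    · intro y
      constructor
      · rintro ⟨h2, h3⟩
        obtain ⟨c, hc, hcs⟩ := Finset.exists_of_ssubset h2
        have hy : y.card = (insert c s).card := by
          have := Finset.card_lt_card h2
          have := Finset.card_lt_card h3
          rw [Finset.card_insert_of_notMem hcs]
          omega
        have he := Finset.eq_of_subset_of_card_le (Finset.insert_subset hc h2.1) hy.le
        rcases (hmem c).1 ⟨h3.1 hc, hcs⟩ with hci | hci <;> subst hci
        · exact Or.inl he.symm
        · exact Or.inr he.symm
      · have key : ∀ k l, k ∈ t ∧ k ∉ s → l ∈ t ∧ l ∉ s → k ≠ l →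
            s < insert k s ∧ insert k s < t := by
          intro k l hk hl hkl
          refine ⟨Finset.ssubset_insert hk.2, Finset.ssubset_iff_subset_ne.2
            ⟨Finset.insert_subset hk.1 h.1, ?_⟩⟩
          rintro rfl
          rcases Finset.mem_insert.1 hl.1 with h4 | h4
          · exact hkl h4.symm
          · exact hl.2 h4
        rintro (rfl | rfl)
        · exact key i j hi hj hij
        · exact key j i hj hi hij.symm

omit [Fintype α] in
theorem hasAdjacentFacets_finset : HasAdjacentFacets (Finset α) Finset.card := by
  intro z σ τ h1 h2 h3 h4
  by_cases h : σ = τ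
  · exact Or.inl h
  refine Or.inr ?_
  have h5 := Finset.card_union_add_card_inter σ τ
  have h6 := Finset.card_le_card (Finset.union_subset h1 h2)
  have h7 : (σ ∩ τ).card < σ.card := Finset.card_lt_card
    (Finset.ssubset_iff_subset_ne.2 ⟨Finset.inter_subset_left, fun he =>
      h (Finset.eq_of_subset_of_card_le (Finset.inter_eq_left.1 he) (by omega))⟩)
  change (σ ∩ τ).card + 2 = _
  omega

omit [DecidableEq α] in
theorem ncard_card_eq_one : {s : Finset α | s.card = 1}.ncard = Fintype.card α := by
  have : {s : Finset α | s.card = 1} = Set.range (fun a : α => ({a} : Finset α)) := by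
    ext s
    simp [Finset.card_eq_one, eq_comm]
  rw [this, ← Nat.card_coe_set_eq, Nat.card_range_of_injective Finset.singleton_injective,
    Nat.card_eq_fintype_card]

end Simplex

section SimplexJoin

variable {a b : ℕ}

instance : Finite (Join (Finset (Fin a)) (Finset (Fin b))) :=
  inferInstanceAs (Finite {_p : Finset (Fin a) × Finset (Fin b) // _})

theorem finset_bot_lt_top {n : ℕ} (hn : 1 ≤ n) : (⊥ : Finset (Fin n)) < ⊤ := by
  rw [lt_top_iff_ne_top]
  intro h
  have := congrArg Finset.card h
  simp at this
  omega

theorem isGraded_simplexJoin (ha : 1 ≤ a) (hb : 1 ≤ b) :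
    IsGraded (Join (Finset (Fin a)) (Finset (Fin b))) (joinRank Finset.card Finset.card) :=
  isGraded_finset.join isGraded_finset (finset_bot_lt_top ha) (finset_bot_lt_top hb)

theorem hasFacetDiameterTwo_simplexJoin :
    HasFacetDiameterTwo (Join (Finset (Fin a)) (Finset (Fin b)))
      (joinRank Finset.card Finset.card) :=
  HasAdjacentFacets.join isGraded_finset isGraded_finset hasAdjacentFacets_finset
    hasAdjacentFacets_finset

variable {m : ℕ}

theorem isGraded_simplexJoinProd (ha : 1 ≤ a) (hb : 1 ≤ b) :
    IsGraded (SimplexJoinProd a b m)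
      (fun p => joinRank Finset.card Finset.card p.1 + p.2.card) :=
  (isGraded_simplexJoin ha hb).prod isGraded_finset

theorem isCellularPseudomanifold_simplexJoinProd (ha : 1 ≤ a) (hb : 1 ≤ b) :
    IsCellularPseudomanifold (SimplexJoinProd a b m) :=
  (isGraded_simplexJoinProd ha hb).isCellularPseudomanifold
    (hasFacetDiameterTwo_simplexJoin.prod (isGraded_simplexJoin ha hb) isGraded_finset
      hasAdjacentFacets_finset.hasFacetDiameterTwo)

theorem dim_simplexJoinProd (ha : 1 ≤ a) (hb : 1 ≤ b) :
    dim (SimplexJoinProd a b m) = a + b + m - 3 := by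
  rw [dim, (isGraded_simplexJoinProd ha hb).rank_eq, Prod.fst_top, Prod.snd_top, joinRank_top]
  simp only [Finset.top_eq_univ, Finset.card_univ, Fintype.card_fin]
  omega

theorem excess_simplexJoinProd (ha : 2 ≤ a) (hb : 2 ≤ b) :
    excess (SimplexJoinProd a b m) = 1 := by
  have hg := isGraded_simplexJoinProd (m := m) (show 1 ≤ a by omega) (show 1 ≤ b by omega)
  have h1 : numVertices (SimplexJoinProd a b m) = a + b + m := by
    rw [numVertices]
    simp only [hg.rank_eq]
    rw [(isGraded_simplexJoin (by omega) (by omega)).ncard_prod isGraded_finset,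
      isGraded_finset.ncard_join isGraded_finset (by simpa using ha) (by simpa using hb),
      ncard_card_eq_one, ncard_card_eq_one, ncard_card_eq_one]
    simp
  rw [excess, h1, dim_simplexJoinProd (by omega) (by omega)]
  push_cast
  ring

end SimplexJoin

/-! ### Exposed faces of a convex hull -/

section Exposed

variable {ι : Type*} {E : Type*} [NormedAddCommGroup E] [NormedSpace ℝ E] {v : ι → E}

/-- A non-empty closed face of a polytope is cut out by a supporting hyperplane. -/
theorem exists_supporting_of_isExposed {F : Set E}
    (hF : IsExposed ℝ (convexHull ℝ (Set.range v)) F) (hne : F.Nonempty) :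
    ∃ (l : StrongDual ℝ E) (c : ℝ), (∀ y ∈ convexHull ℝ (Set.range v), l y ≤ c) ∧
      F = {x ∈ convexHull ℝ (Set.range v) | l x = c} := by
  obtain ⟨l, hl⟩ := hF hne
  obtain ⟨x₀, hx₀⟩ := hne
  rw [hl] at hx₀
  refine ⟨l, l x₀, hx₀.2, ?_⟩
  rw [hl]
  ext x
  constructor
  · rintro ⟨h1, h2⟩
    exact ⟨h1, le_antisymm (hx₀.2 x h1) (h2 x₀ hx₀.1)⟩
  · rintro ⟨h1, h2⟩
    exact ⟨h1, fun y hy => h2 ▸ hx₀.2 y hy⟩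

/-- A point of `F` maximizes the supporting functional. In a convex combination of vertices giving
this point, every vertex of nonzero weight must also attain the maximum, so it lies in `F`. -/
theorem IsExposed.subset_of_vertices {F F' : Set E}
    (hF : IsExposed ℝ (convexHull ℝ (Set.range v)) F) (hF' : Convex ℝ F')
    (h : ∀ i, v i ∈ F → v i ∈ F') : F ⊆ F' := by
  intro x hx
  obtain ⟨l, c, hle, hl⟩ := exists_supporting_of_isExposed hF ⟨x, hx⟩
  have hx' := hx
  rw [hl] at hx'
  obtain ⟨hxP, hxc⟩ := hx'
  obtain ⟨κ, _, w, z, hw0, hw1, hz, rfl⟩ := mem_convexHull_iff_exists_fintype.1 hxP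
  have hzP : ∀ k, z k ∈ convexHull ℝ (Set.range v) := fun k => subset_convexHull _ _ (hz k)
  have hsum : ∑ k, w k * (c - l (z k)) = 0 := by
    simp only [mul_sub, Finset.sum_sub_distrib, ← Finset.sum_mul, hw1, one_mul]
    rw [← hxc, map_sum]
    simp
  rw [Finset.sum_eq_zero_iff_of_nonneg fun k _ =>
    mul_nonneg (hw0 k) (sub_nonneg.2 (hle _ (hzP k)))] at hsum
  have hzF : ∀ k, w k ≠ 0 → z k ∈ F' := by
    intro k hk
    have h1 : c - l (z k) = 0 := by
      have := hsum k (Finset.mem_univ k)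
      exact (mul_eq_zero.1 this).resolve_left hk
    obtain ⟨i, hi⟩ := hz k
    have h2 : z k ∈ F := by
      rw [hl]
      exact ⟨hzP k, by linarith⟩
    rw [← hi] at h2 ⊢
    exact h i h2
  rw [← Finset.sum_filter_of_ne (p := fun k => w k ≠ 0) (fun k _ hk h0 => hk (by simp [h0]))]
  refine hF'.sum_mem (fun k _ => hw0 k) ?_ fun k hk => hzF k (Finset.mem_filter.1 hk).2
  rw [← hw1]
  exact Finset.sum_filter_ne_zero _

theorem exists_isExposed_of_supporting (l : StrongDual ℝ E) (c : ℝ) (hle : ∀ i, l (v i) ≤ c)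
    (hc : ∃ i, l (v i) = c) :
    ∃ F, IsExposed ℝ (convexHull ℝ (Set.range v)) F ∧ ∀ i, v i ∈ F ↔ l (v i) = c := by
  have hle' : ∀ y ∈ convexHull ℝ (Set.range v), l y ≤ c := by
    have : convexHull ℝ (Set.range v) ⊆ {y | l y ≤ c} := by
      refine convexHull_min ?_ (convex_halfSpace_le l.toLinearMap.isLinear c)
      rintro _ ⟨i, rfl⟩
      exact hle i
    exact fun y hy => this hy
  have hv : ∀ i, v i ∈ convexHull ℝ (Set.range v) := fun i =>
    subset_convexHull _ _ (Set.mem_range_self i)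
  obtain ⟨j, hj⟩ := hc
  refine ⟨{x ∈ convexHull ℝ (Set.range v) | ∀ y ∈ convexHull ℝ (Set.range v), l y ≤ l x},
    fun _ => ⟨l, rfl⟩, fun i => ?_⟩
  constructor
  · rintro ⟨-, h⟩
    exact le_antisymm (hle i) (hj ▸ h _ (hv j))
  · intro h
    exact ⟨hv i, fun y hy => h ▸ hle' y hy⟩

end Exposed

/-! ### Realization by polytopes -/

section SimplexPolytope

variable {E : Type*} [NormedAddCommGroup E] [NormedSpace ℝ E]

/-- The vertices of a simplex with the origin in its interior. -/
noncomputable def simplexVertex {n : ℕ} (u : Fin n → E) : Fin (n + 1) → E :=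
  Fin.lastCases (-∑ j, u j) u

omit [NormedSpace ℝ E] in
theorem simplexVertex_castSucc {n : ℕ} (u : Fin n → E) (j : Fin n) :
    simplexVertex u j.castSucc = u j := by
  simp [simplexVertex]

omit [NormedSpace ℝ E] in
theorem sum_simplexVertex {n : ℕ} (u : Fin n → E) : ∑ i, simplexVertex u i = 0 := by
  rw [Fin.sum_univ_castSucc]
  simp [simplexVertex]

theorem apply_simplexVertex {n : ℕ} (u : Fin n → E) (l : StrongDual ℝ E)
    {α : Fin (n + 1) → ℝ} (hα : ∑ i, α i = 0) (h : ∀ j, l (u j) = α j.castSucc)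
    (i : Fin (n + 1)) : l (simplexVertex u i) = α i := by
  rw [Fin.sum_univ_castSucc] at hα
  refine Fin.lastCases ?_ (fun j => ?_) i
  · simp only [simplexVertex, Fin.lastCases_last, map_neg, map_sum, h]
    linarith
  · rw [simplexVertex_castSucc, h]

/-- This links the two blocks: whether a supporting functional is maximal on a whole block depends
only on the level `c`, the same for both. -/
theorem forall_eq_iff_eq_zero {n : ℕ} {α : Fin (n + 1) → ℝ} {c : ℝ} (hα : ∑ i, α i = 0)
    (hle : ∀ i, α i ≤ c) : (∀ i, α i = c) ↔ c = 0 := by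
  constructor
  · intro h
    simp only [h, Finset.sum_const, Finset.card_univ, Fintype.card_fin, nsmul_eq_mul] at hα
    rcases mul_eq_zero.1 hα with h1 | h1
    · exact absurd h1 (by positivity)
    · exact h1
  · rintro rfl i
    exact (Finset.sum_eq_zero_iff_of_nonpos fun i _ => hle i).1 hα i (Finset.mem_univ i)

theorem exists_sum_eq_zero {n : ℕ} {s : Finset (Fin n)} (hs : s ≠ ⊤) :
    ∃ α : Fin n → ℝ, ∑ i, α i = 0 ∧ (∀ i, α i ≤ 1) ∧ ∀ i, α i = 1 ↔ i ∈ s := by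
  have hc : (0 : ℝ) < (sᶜ.card : ℝ) := by
    have : sᶜ.Nonempty := by
      rw [Finset.nonempty_iff_ne_empty, Ne, Finset.compl_eq_empty_iff]
      exact hs
    exact_mod_cast this.card_pos
  have hneg : -((s.card : ℝ) / sᶜ.card) ≤ 0 := neg_nonpos.2 (by positivity)
  -- The constant off `s` is chosen to balance the ones on `s`; the complement is nonempty since `s`
  -- is not full.
  refine ⟨fun i => if i ∈ s then 1 else -((s.card : ℝ) / sᶜ.card), ?_, fun i => ?_, fun i => ?_⟩
  · rw [← Finset.sum_add_sum_compl s,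
      Finset.sum_congr rfl (fun i (hi : i ∈ s) => if_pos hi),
      Finset.sum_congr rfl (fun i (hi : i ∈ sᶜ) => if_neg (Finset.mem_compl.1 hi))]
    simp only [Finset.sum_const, nsmul_eq_mul]
    field_simp
    ring
  · dsimp only
    split_ifs
    · exact le_rfl
    · linarith
  · by_cases hi : i ∈ s
    · simp [hi]
    · simp only [hi, if_false, iff_false]
      intro h
      linarith

variable {p q m : ℕ}

/-- The vertices of the direct sum of two simplices, and the apices of `m` pyramids over it. -/
noncomputable def joinVertex (u : Fin p ⊕ Fin q ⊕ Fin m → E) :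
    Fin (p + 1) ⊕ Fin (q + 1) ⊕ Fin m → E :=
  Sum.elim (simplexVertex fun i => u (Sum.inl i)) (Sum.elim
    (simplexVertex fun i => u (Sum.inr (Sum.inl i))) fun i => u (Sum.inr (Sum.inr i)))

theorem exists_apply_joinVertex [FiniteDimensional ℝ E]
    (u : Module.Basis (Fin p ⊕ Fin q ⊕ Fin m) ℝ E)
    {α : Fin (p + 1) → ℝ} {β : Fin (q + 1) → ℝ} (γ : Fin m → ℝ) (hα : ∑ i, α i = 0)
    (hβ : ∑ i, β i = 0) :
    ∃ l : StrongDual ℝ E, ∀ i, l (joinVertex u i) = Sum.elim α (Sum.elim β γ) i := by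
  refine ⟨LinearMap.toContinuousLinearMap (u.constr ℝ (Sum.elim (fun i => α i.castSucc)
    (Sum.elim (fun i => β i.castSucc) γ))), ?_⟩
  rintro (i | i | i)
  · exact apply_simplexVertex _ _ hα (fun j => by simp) i
  · exact apply_simplexVertex _ _ hβ (fun j => by simp) i
  · simp [joinVertex]

theorem interior_convexHull_joinVertex_nonempty [FiniteDimensional ℝ E]
    (u : Module.Basis (Fin p ⊕ Fin q ⊕ Fin m) ℝ E) :
    (interior (convexHull ℝ (Set.range (joinVertex u)))).Nonempty := by
  rw [interior_convexHull_nonempty_iff_affineSpan_eq_top]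
  -- The origin is the barycentre of the first simplex; together with the basis vectors, which are
  -- among the vertices, it affinely spans the space.
  have h0 : (0 : E) ∈ affineSpan ℝ (Set.range (joinVertex u)) := by
    apply convexHull_subset_affineSpan
    refine mem_convexHull_of_exists_fintype (fun _ : Fin (p + 1) => ((p : ℝ) + 1)⁻¹)
      (fun i => joinVertex u (Sum.inl i)) (fun _ => by positivity) ?_
      (fun i => Set.mem_range_self _) ?_
    · simp only [Finset.sum_const, Finset.card_univ, Fintype.card_fin, nsmul_eq_mul]
      push_cast
      exact mul_inv_cancel₀ (by positivity)
    · rw [← Finset.smul_sum]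
      simp [joinVertex, sum_simplexVertex]
  have hu : ∀ j, u j ∈ Set.range (joinVertex u) := by
    rintro (j | j | j)
    · exact ⟨Sum.inl j.castSucc, simplexVertex_castSucc _ j⟩
    · exact ⟨Sum.inr (Sum.inl j.castSucc), simplexVertex_castSucc _ j⟩
    · exact ⟨Sum.inr (Sum.inr j), rfl⟩
  rw [← AffineSubspace.direction_eq_top_iff_of_nonempty ⟨0, h0⟩, eq_top_iff, ← u.span_eq,
    Submodule.span_le]
  rintro _ ⟨j, rfl⟩
  have := AffineSubspace.vsub_mem_direction (subset_affineSpan ℝ _ (hu j)) h0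
  simpa using this

open Classical in
/-- The vertices on a closed face, sorted by blocks. -/
noncomputable def faceVertices (u : Fin p ⊕ Fin q ⊕ Fin m → E) (F : Set E) :
    Finset (Fin (p + 1)) × Finset (Fin (q + 1)) × Finset (Fin m) :=
  (Finset.univ.filter fun i => joinVertex u (Sum.inl i) ∈ F,
    Finset.univ.filter fun i => joinVertex u (Sum.inr (Sum.inl i)) ∈ F,
    Finset.univ.filter fun i => joinVertex u (Sum.inr (Sum.inr i)) ∈ F)

/-- The face lattice of the polytope spanned by `joinVertex u`. -/
theorem nonempty_orderIso_isExposed [FiniteDimensional ℝ E]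
    (u : Module.Basis (Fin p ⊕ Fin q ⊕ Fin m) ℝ E) :
    Nonempty ({F : Set E // IsExposed ℝ (convexHull ℝ (Set.range (joinVertex u))) F} ≃o
      SimplexJoinProd (p + 1) (q + 1) m) := by
  classical
  refine nonempty_orderIso_simplexJoinProd (fun F => faceVertices u F.1) ?_ ?_
  · rintro ⟨F, hF⟩ ⟨F', hF'⟩
    simp only [faceVertices, Subtype.mk_le_mk, Prod.mk_le_mk, Finset.subset_iff,
      Finset.mem_filter, Finset.mem_univ, true_and]
    constructor
    · exact fun h => ⟨fun i hi => h hi, fun i hi => h hi, fun i hi => h hi⟩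
    · rintro ⟨h1, h2, h3⟩
      refine IsExposed.subset_of_vertices hF (hF'.convex (convex_convexHull ℝ _)) ?_
      rintro (i | i | i)
      · exact @h1 i
      · exact @h2 i
      · exact @h3 i
  · rintro ⟨s, t, w⟩
    have hsum : ∀ {n : ℕ} (u : Fin n → E) (l : StrongDual ℝ E),
        ∑ i, l (simplexVertex u i) = 0 := by
      intro n u l
      rw [← map_sum, sum_simplexVertex, map_zero]
    have hex : ∀ (c : ℝ) (α : Fin (p + 1) → ℝ) (β : Fin (q + 1) → ℝ) (γ : Fin m → ℝ),
        ∑ i, α i = 0 → ∑ i, β i = 0 → (∀ i, α i ≤ c) → (∀ i, β i ≤ c) → (∀ i, γ i ≤ c) →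
        (∀ i, α i = c ↔ i ∈ s) → (∀ i, β i = c ↔ i ∈ t) → (∀ i, γ i = c ↔ i ∈ w) →
        ∃ F : {F : Set E // IsExposed ℝ (convexHull ℝ (Set.range (joinVertex u))) F},
          faceVertices u F.1 = (s, t, w) := by
      intro c α β γ hα hβ hαc hβc hγc hs ht hw
      obtain ⟨l, hl⟩ := exists_apply_joinVertex u γ hα hβ
      by_cases hne : ∃ i, l (joinVertex u i) = c
      · obtain ⟨F, hF, hF'⟩ := exists_isExposed_of_supporting (v := joinVertex u) l c (by
          rintro (i | i | i) <;> simp [hl, hαc, hβc, hγc]) hne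
        refine ⟨⟨F, hF⟩, Prod.ext ?_ (Prod.ext ?_ ?_)⟩ <;> ext i <;> simp [faceVertices, hF', hl, hs, ht, hw]
      -- No vertex reaches the level `c`, so `s`, `t`, `w` are all empty and the empty face realizes
      -- them.
      · push Not at hne
        refine ⟨⟨∅, fun h => absurd h Set.not_nonempty_empty⟩, Prod.ext ?_ (Prod.ext ?_ ?_)⟩ <;>
          ext i
        · simpa [faceVertices, ← hs, hl] using hne (Sum.inl i)
        · simpa [faceVertices, ← ht, hl] using hne (Sum.inr (Sum.inl i))
        · simpa [faceVertices, ← hw, hl] using hne (Sum.inr (Sum.inr i))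
    constructor
    · rintro ⟨⟨F, hF⟩, h⟩
      simp only [faceVertices, Prod.mk.injEq] at h
      obtain ⟨rfl, rfl, -⟩ := h
      simp only [Finset.top_eq_univ, Finset.eq_univ_iff_forall, Finset.mem_filter,
        Finset.mem_univ, true_and]
      rcases F.eq_empty_or_nonempty with rfl | hne
      · simp
      · obtain ⟨l, c, hle, hl⟩ := exists_supporting_of_isExposed hF hne
        have hv : ∀ i, joinVertex u i ∈ convexHull ℝ (Set.range (joinVertex u)) := fun i =>
          subset_convexHull _ _ (Set.mem_range_self i)
        have hvF : ∀ i, joinVertex u i ∈ F ↔ l (joinVertex u i) = c := by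
          intro i
          rw [hl]
          exact ⟨fun h => h.2, fun h => ⟨hv i, h⟩⟩
        simp only [hvF]
        rw [forall_eq_iff_eq_zero (α := fun i => l (joinVertex u (Sum.inl i))) (hsum _ l)
            (fun i => hle _ (hv _)),
          forall_eq_iff_eq_zero (α := fun i => l (joinVertex u (Sum.inr (Sum.inl i)))) (hsum _ l)
            (fun i => hle _ (hv _))]
    · intro h
      by_cases hs : s = ⊤
      · have ht : t = ⊤ := h.1 hs
        subst hs
        subst ht
        -- Full blocks force level zero. For blocks that are not full, level one is used below.
        refine hex 0 0 0 (fun i => if i ∈ w then 0 else -1) (by simp) (by simp) (by simp)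
          (by simp) (fun i => by split_ifs <;> norm_num) (by simp) (by simp) (fun i => by simp)
      · have ht : t ≠ ⊤ := fun ht => hs (h.2 ht)
        obtain ⟨α, hα, hα1, hαs⟩ := exists_sum_eq_zero hs
        obtain ⟨β, hβ, hβ1, hβt⟩ := exists_sum_eq_zero ht
        exact hex 1 α β (fun i => if i ∈ w then 1 else 0) hα hβ hα1 hβ1
          (fun i => by split_ifs <;> norm_num) hαs hβt (fun i => by simp)

end SimplexPolytope

theorem IsPolytopalSphere.congr {X : Type u} {Y : Type v} [Lattice X] [BoundedOrder X] [Lattice Y]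
    [BoundedOrder Y] (f : X ≃o Y) (h : IsPolytopalSphere X) : IsPolytopalSphere Y := by
  obtain ⟨h1, k, S, h2, ⟨g⟩⟩ := h
  exact ⟨h1.congr f, k, S, h2, ⟨f.symm.trans g⟩⟩

theorem isPolytopalSphere_simplexJoinProd {a b m : ℕ} (ha : 1 ≤ a) (hb : 1 ≤ b) :
    IsPolytopalSphere (SimplexJoinProd a b m) := by
  classical
  refine ⟨isCellularPseudomanifold_simplexJoinProd ha hb, ?_⟩
  obtain ⟨p, rfl⟩ := Nat.exists_eq_add_of_le' ha
  obtain ⟨q, rfl⟩ := Nat.exists_eq_add_of_le' hb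
  let e : Fin p ⊕ Fin q ⊕ Fin m ≃ Fin (p + (q + m)) :=
    ((Equiv.refl _).sumCongr finSumFinEquiv).trans finSumFinEquiv
  let u : Module.Basis (Fin p ⊕ Fin q ⊕ Fin m) ℝ (EuclideanSpace ℝ (Fin (p + (q + m)))) :=
    (EuclideanSpace.basisFun (Fin (p + (q + m))) ℝ).toBasis.reindex e.symm
  refine ⟨p + (q + m), Finset.univ.image (joinVertex u), ?_⟩
  rw [Finset.coe_image, Finset.coe_univ, Set.image_univ]
  exact ⟨interior_convexHull_joinVertex_nonempty u,
    (nonempty_orderIso_isExposed u).map OrderIso.symm⟩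

/-! ### Distinguishing the parameters by counting faces -/

theorem card_join (a b : ℕ) :
    Nat.card (Join (Finset (Fin a)) (Finset (Fin b))) = (2 ^ a - 1) * (2 ^ b - 1) + 1 := by
  have h : ∀ n : ℕ, ({⊤}ᶜ : Set (Finset (Fin n))).ncard = 2 ^ n - 1 := by
    intro n
    rw [Set.ncard_compl, Set.ncard_singleton]
    simp
  have hset : {p : Finset (Fin a) × Finset (Fin b) | (p.1 < ⊤ ∧ p.2 < ⊤) ∨ (p.1 = ⊤ ∧ p.2 = ⊤)} =
      insert (⊤, ⊤) (({⊤}ᶜ : Set (Finset (Fin a))) ×ˢ ({⊤}ᶜ : Set (Finset (Fin b)))) := by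
    ext ⟨s, t⟩
    simp only [lt_top_iff_ne_top, Set.mem_ofPred_eq, Set.mem_insert_iff, Prod.mk.injEq,
      Set.mem_prod, Set.mem_compl_iff, Set.mem_singleton_iff]
    tauto
  rw [← h a, ← h b, ← Set.ncard_prod, ← Set.ncard_insert_of_notMem (a := (⊤, ⊤)) (by simp),
    ← hset, ← Nat.card_coe_set_eq]
  rfl

theorem card_simplexJoinProd (a b m : ℕ) :
    Nat.card (SimplexJoinProd a b m) = ((2 ^ a - 1) * (2 ^ b - 1) + 1) * 2 ^ m := by
  rw [Nat.card_prod, card_join]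
  simp

theorem not_two_pow_mul_eq {m m' K K' : ℕ} (hm : m < m') (hK : Odd K) :
    2 ^ m * K ≠ 2 ^ m' * K' := by
  obtain ⟨k, rfl⟩ := Nat.exists_eq_add_of_lt hm
  intro h
  rw [pow_add, pow_add, mul_assoc, mul_assoc] at h
  have h2 := Nat.eq_of_mul_eq_mul_left (by positivity) h
  rw [h2, mul_left_comm, pow_one] at hK
  exact absurd hK (Nat.not_odd_iff_even.2 (even_two_mul _))

/-- Since `y ≥ y' + 1`, the single power `2 ^ y` already dominates `2 ^ x' + 2 ^ y'`. -/
theorem two_pow_add_lt {x y x' y' : ℕ} (hxy' : x' ≤ y') (h : x + y = x' + y')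
    (hlt : x < x') : 2 ^ x' + 2 ^ y' < 2 ^ x + 2 ^ y := by
  have h1 : 2 ^ x' ≤ 2 ^ y' := Nat.pow_le_pow_right (by norm_num) hxy'
  have h2 : 2 ^ (y' + 1) ≤ 2 ^ y := Nat.pow_le_pow_right (by norm_num) (by omega)
  have h3 : 0 < 2 ^ x := by positivity
  rw [pow_succ] at h2
  omega

/-- Subtracting the number of faces from `2 ^ (a + b + m)` leaves `2 ^ (m + 1)` times an odd number,
where oddness uses `2 ≤ a, b`. The power of two gives `m`, and then `2 ^ (a - 1) + 2 ^ (b - 1)` with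
the known sum `a + b` gives `a` and `b`. -/
theorem eq_of_card_eq {a b m a' b' m' : ℕ} (ha : 2 ≤ a) (hab : a ≤ b) (ha' : 2 ≤ a')
    (hab' : a' ≤ b') (hs : a + b + m = a' + b' + m')
    (hc : ((2 ^ a - 1) * (2 ^ b - 1) + 1) * 2 ^ m =
      ((2 ^ a' - 1) * (2 ^ b' - 1) + 1) * 2 ^ m') : a = a' ∧ b = b' ∧ m = m' := by
  have key : ∀ {a b : ℕ} (m : ℕ), 2 ≤ a → 2 ≤ b →
      ((2 ^ a - 1) * (2 ^ b - 1) + 1) * 2 ^ m +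
        2 ^ (m + 1) * (2 ^ (a - 1) + 2 ^ (b - 1) - 1) = 2 ^ (a + b + m) ∧
      Odd (2 ^ (a - 1) + 2 ^ (b - 1) - 1) := by
    intro a b m ha hb
    obtain ⟨x, rfl⟩ := Nat.exists_eq_add_of_le' ha
    obtain ⟨y, rfl⟩ := Nat.exists_eq_add_of_le' hb
    rw [show x + 2 - 1 = x + 1 by omega, show y + 2 - 1 = y + 1 by omega]
    obtain ⟨p, hp⟩ := Nat.exists_eq_succ_of_ne_zero (show 2 ^ x ≠ 0 by positivity)
    obtain ⟨q, hq⟩ := Nat.exists_eq_succ_of_ne_zero (show 2 ^ y ≠ 0 by positivity)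
    simp only [pow_add, hp, hq, pow_one, Nat.succ_eq_add_one]
    rw [show (p + 1) * 2 ^ 2 - 1 = 4 * p + 3 by omega,
      show (q + 1) * 2 ^ 2 - 1 = 4 * q + 3 by omega,
      show (p + 1) * 2 + (q + 1) * 2 - 1 = 2 * (p + q + 1) + 1 by omega]
    exact ⟨by ring, ⟨_, rfl⟩⟩
  obtain ⟨h1, h2⟩ := key m ha (ha.trans hab)
  obtain ⟨h1', h2'⟩ := key m' ha' (ha'.trans hab')
  have h3 : 2 ^ (m + 1) * (2 ^ (a - 1) + 2 ^ (b - 1) - 1) =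
      2 ^ (m' + 1) * (2 ^ (a' - 1) + 2 ^ (b' - 1) - 1) := by
    rw [← hs] at h1'
    omega
  have hm : m = m' := by
    rcases lt_trichotomy m m' with h | h | h
    · exact absurd h3 (not_two_pow_mul_eq (by omega) h2)
    · exact h
    · exact absurd h3.symm (not_two_pow_mul_eq (by omega) h2')
  subst hm
  have h4 := Nat.eq_of_mul_eq_mul_left (by positivity) h3
  have h5 : 2 ^ (a - 1) + 2 ^ (b - 1) = 2 ^ (a' - 1) + 2 ^ (b' - 1) :=
    Nat.sub_one_cancel (by positivity) (by positivity) h4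
  rcases lt_trichotomy a a' with h | h | h
  · exact absurd h5.symm (two_pow_add_lt (by omega) (by omega) (by omega)).ne
  · omega
  · exact absurd h5 (two_pow_add_lt (by omega) (by omega) (by omega)).ne

theorem eq_of_simplexJoinProd_orderIso {a b m a' b' m' : ℕ} (ha : 2 ≤ a) (hab : a ≤ b)
    (ha' : 2 ≤ a') (hab' : a' ≤ b')
    (f : Nonempty (SimplexJoinProd a b m ≃o SimplexJoinProd a' b' m')) :
    a = a' ∧ b = b' ∧ m = m' := by
  obtain ⟨f⟩ := f
  have h1 := dim_congr f
  rw [dim_simplexJoinProd (by omega) (by omega), dim_simplexJoinProd (by omega) (by omega)] at h1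
  have h2 := Nat.card_congr f.toEquiv
  rw [card_simplexJoinProd, card_simplexJoinProd] at h2
  exact eq_of_card_eq ha hab ha' hab' (by omega) h2

/-! ### The classification and the number of classes -/

theorem isCellularPseudomanifold_and_excess_iff {X : Type u} [Lattice X] [BoundedOrder X]
    {d : ℤ} : (IsCellularPseudomanifold X ∧ dim X = d ∧ excess X = 1) ↔
      ∃ a b m : ℕ, (2 ≤ a ∧ a ≤ b ∧ (a + b + m : ℤ) = d + 3) ∧
        Nonempty (X ≃o SimplexJoinProd a b m) := by
  constructor
  · rintro ⟨h, rfl, he⟩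
    obtain ⟨a, b, m, h1, h2, h3, h4⟩ := h.exists_orderIso_simplexJoinProd he
    exact ⟨a, b, m, ⟨h1, h2, h3⟩, h4⟩
  · rintro ⟨a, b, m, ⟨h1, h2, h3⟩, ⟨f⟩⟩
    refine ⟨(isCellularPseudomanifold_simplexJoinProd (by omega) (by omega)).congr f.symm, ?_, ?_⟩
    · rw [dim_congr f, dim_simplexJoinProd (by omega) (by omega)]
      omega
    · rw [excess_congr f, excess_simplexJoinProd (by omega) (by omega)]

/-- A join of simplices as a product with a one-point lattice. -/
def joinOrderIso (a b : ℕ) :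
    Join (Finset (Fin a)) (Finset (Fin b)) ≃o SimplexJoinProd a b 0 where
  toFun p := (p, ⊥)
  invFun p := p.1
  left_inv _ := rfl
  right_inv _ := Prod.ext rfl (Subsingleton.elim _ _)
  map_rel_iff' := ⟨fun h => h.1, fun h => ⟨h, le_rfl⟩⟩

/-- The parameters of the `SimplexJoinProd a b m` with `a + b + m = D + 2`. -/
abbrev ParamType (D : ℕ) : Type := Σ x : Fin D, Fin (D - 1 - 2 * x)

theorem sum_range_sub_two_mul (D : ℕ) : ∑ x ∈ Finset.range D, (D - 1 - 2 * x) = D ^ 2 / 4 := by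
  induction D using Nat.twoStepInduction with
  | zero => rfl
  | one => rfl
  | more D ih _ =>
    -- Going from `D` to `D + 2`, the term `x = 0` contributes `D + 1`, the last term vanishes by
    -- truncation, and the others are the old sum shifted by one.
    rw [Finset.sum_range_succ', Finset.sum_range_succ,
      Finset.sum_congr rfl (g := fun x => D - 1 - 2 * x) (fun x _ => by omega), ih,
      show (D + 2) ^ 2 = D ^ 2 + (D + 1) * 4 by ring, Nat.add_mul_div_right _ _ (by norm_num)]
    omega

theorem card_paramType (D : ℕ) : Fintype.card (ParamType D) = D ^ 2 / 4 := by
  rw [Fintype.card_sigma, ← sum_range_sub_two_mul, ← Fin.sum_univ_eq_sum_range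
    (fun x => D - 1 - 2 * x)]
  simp

/-- The member of the list with given parameters. -/
noncomputable def ofParam {d : ℤ} {D : ℕ} (hD : (D : ℤ) = d + 1) (p : ParamType D) :
    CellularPseudomanifold.{u} d 1 :=
  have h : IsCellularPseudomanifold (ULift.{u} (SimplexJoinProd (p.1 + 2) (p.1 + 2 + p.2)
      (D - 2 - 2 * p.1 - p.2))) ∧ dim (ULift.{u} (SimplexJoinProd (p.1 + 2) (p.1 + 2 + p.2)
      (D - 2 - 2 * p.1 - p.2))) = d ∧ excess (ULift.{u} (SimplexJoinProd (p.1 + 2)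
      (p.1 + 2 + p.2) (D - 2 - 2 * p.1 - p.2))) = 1 :=
    isCellularPseudomanifold_and_excess_iff.2 ⟨p.1 + 2, p.1 + 2 + p.2, D - 2 - 2 * p.1 - p.2,
      ⟨by omega, by omega, by have := p.1.2; have := p.2.2; omega⟩, ⟨ULift.orderIso⟩⟩
  { carrier := ULift.{u} (SimplexJoinProd (p.1 + 2) (p.1 + 2 + p.2) (D - 2 - 2 * p.1 - p.2))
    isCellularPseudomanifold := h.1
    dim_eq := h.2.1
    excess_eq := h.2.2 }

/-- The pair `(x, i)` records `a - 2` and `b - a`; then `m` is determined, and `i < D - 1 - 2 * x`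
says that it is nonnegative. Truncated subtraction leaves no `i` when `x` is too large. -/
theorem ofParam_bijective {d : ℤ} {D : ℕ} (hD : (D : ℤ) = d + 1) :
    Function.Bijective fun p : ParamType D =>
      (Quotient.mk (isoSetoid.{u} d 1) (ofParam hD p) : IsoClasses.{u} d 1) := by
  constructor
  · rintro ⟨⟨x, hx⟩, ⟨i, hi⟩⟩ ⟨⟨x', hx'⟩, ⟨i', hi'⟩⟩ h
    obtain ⟨f⟩ := Quotient.exact h
    have h1 := eq_of_simplexJoinProd_orderIso (by omega) (by omega) (by omega) (by omega)
      ⟨ULift.orderIso.symm.trans (f.trans ULift.orderIso)⟩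
    simp only at h1
    obtain rfl : x = x' := by omega
    obtain rfl : i = i' := by omega
    rfl
  · intro c
    induction c using Quotient.inductionOn with
    | _ M =>
      obtain ⟨a, b, m, ⟨h1, h2, h3⟩, ⟨f⟩⟩ := isCellularPseudomanifold_and_excess_iff.1
        ⟨M.isCellularPseudomanifold, M.dim_eq, M.excess_eq⟩
      obtain ⟨x, rfl⟩ := Nat.exists_eq_add_of_le' h1
      obtain ⟨i, rfl⟩ := Nat.exists_eq_add_of_le h2
      obtain rfl : m = D - 2 - 2 * x - i := by omega
      exact ⟨⟨⟨x, by omega⟩, ⟨i, by simp only; omega⟩⟩,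
        Quotient.sound ⟨ULift.orderIso.trans f.symm⟩⟩

theorem card_isoClasses {d : ℤ} (hd : -1 ≤ d) :
    ENat.card (IsoClasses.{u} d 1) = (⌊(((d : ℚ) + 1) / 2) ^ 2⌋₊ : ℕ∞) := by
  obtain ⟨D, hD⟩ := Int.eq_ofNat_of_zero_le (show 0 ≤ d + 1 by omega)
  rw [← ENat.card_congr (Equiv.ofBijective (β := IsoClasses.{u} d 1) _ (ofParam_bijective hD.symm)),
    ENat.card_eq_coe_fintype_card, card_paramType]
  have h1 : (((d : ℚ) + 1) / 2) ^ 2 = ((D ^ 2 : ℕ) : ℚ) / (4 : ℕ) := by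
    have : (d : ℚ) + 1 = D := by exact_mod_cast hD
    rw [this]
    push_cast
    ring
  rw [h1, Nat.floor_div_eq_div]

end Cellular

theorem theorem3p1 (d : ℤ) (hd : -1 ≤ d) :
    -- the classification
    (∀ (X : Type u) [Lattice X] [BoundedOrder X],
      (IsCellularPseudomanifold X ∧ dim X = d ∧ excess X = 1) ↔
        ((∃ b₁ b₂ : ℤ, (0 ≤ b₁ ∧ b₁ ≤ b₂ ∧ b₁ + b₂ = d - 1) ∧
            Nonempty (X ≃o Join (StdSphere b₁) (StdSphere b₂))) ∨
          (∃ d₁ d₂ d₃ : ℤ, (0 ≤ d₁ ∧ d₁ ≤ d₂ ∧ -1 ≤ d₃ ∧ d₁ + d₂ + d₃ = d - 3) ∧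
            Nonempty (X ≃o
              DirectProduct (Join (StdSphere d₁) (StdSphere d₂)) (StdSphere d₃))))) ∧
    -- the members of the list are mutually non-isomorphic
    (∀ b₁ b₂ c₁ c₂ : ℤ,
      (0 ≤ b₁ ∧ b₁ ≤ b₂ ∧ b₁ + b₂ = d - 1) → (0 ≤ c₁ ∧ c₁ ≤ c₂ ∧ c₁ + c₂ = d - 1) →
      Nonempty (Join (StdSphere b₁) (StdSphere b₂) ≃o Join (StdSphere c₁) (StdSphere c₂)) →
      (b₁, b₂) = (c₁, c₂)) ∧
    (∀ d₁ d₂ d₃ e₁ e₂ e₃ : ℤ,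
      (0 ≤ d₁ ∧ d₁ ≤ d₂ ∧ -1 ≤ d₃ ∧ d₁ + d₂ + d₃ = d - 3) →
      (0 ≤ e₁ ∧ e₁ ≤ e₂ ∧ -1 ≤ e₃ ∧ e₁ + e₂ + e₃ = d - 3) →
      Nonempty (DirectProduct (Join (StdSphere d₁) (StdSphere d₂)) (StdSphere d₃) ≃o
        DirectProduct (Join (StdSphere e₁) (StdSphere e₂)) (StdSphere e₃)) →
      (d₁, d₂, d₃) = (e₁, e₂, e₃)) ∧
    (∀ b₁ b₂ d₁ d₂ d₃ : ℤ,
      (0 ≤ b₁ ∧ b₁ ≤ b₂ ∧ b₁ + b₂ = d - 1) →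
      (0 ≤ d₁ ∧ d₁ ≤ d₂ ∧ -1 ≤ d₃ ∧ d₁ + d₂ + d₃ = d - 3) →
      IsEmpty (Join (StdSphere b₁) (StdSphere b₂) ≃o
        DirectProduct (Join (StdSphere d₁) (StdSphere d₂)) (StdSphere d₃))) ∧
    -- they are polytopal spheres
    (∀ b₁ b₂ : ℤ, (0 ≤ b₁ ∧ b₁ ≤ b₂ ∧ b₁ + b₂ = d - 1) →
      IsPolytopalSphere (Join (StdSphere b₁) (StdSphere b₂))) ∧
    (∀ d₁ d₂ d₃ : ℤ, (0 ≤ d₁ ∧ d₁ ≤ d₂ ∧ -1 ≤ d₃ ∧ d₁ + d₂ + d₃ = d - 3) →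
      IsPolytopalSphere
        (DirectProduct (Join (StdSphere d₁) (StdSphere d₂)) (StdSphere d₃))) ∧
    -- their number up to isomorphism
    ENat.card (IsoClasses.{u} d 1) = (⌊(((d : ℚ) + 1) / 2) ^ 2⌋₊ : ℕ∞) := by
  refine ⟨fun X _ _ => ?_, ?_, ?_, ?_, ?_, ?_, card_isoClasses hd⟩
  · rw [isCellularPseudomanifold_and_excess_iff]
    constructor
    · rintro ⟨a, b, m, ⟨h1, h2, h3⟩, ⟨f⟩⟩
      have ha : ((a : ℤ) - 2 + 2).toNat = a := by omega
      have hb : ((b : ℤ) - 2 + 2).toNat = b := by omega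
      have hm : ((m : ℤ) - 2 + 2).toNat = m := by omega
      -- The sphere `S^b_{b+2}` has `b + 2` points, so parameters shift by two. The case `m = 0`
      -- would be `d₃ = -2`, outside the range of the direct products; it is the family of joins.
      rcases Nat.eq_zero_or_pos m with rfl | hm0
      · refine Or.inl ⟨a - 2, b - 2, ⟨by omega, by omega, by omega⟩, ?_⟩
        change Nonempty (X ≃o Join (Finset (Fin ((a : ℤ) - 2 + 2).toNat))
          (Finset (Fin ((b : ℤ) - 2 + 2).toNat)))
        rw [ha, hb]
        exact ⟨f.trans (joinOrderIso a b).symm⟩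
      · refine Or.inr ⟨a - 2, b - 2, m - 2, ⟨by omega, by omega, by omega, by omega⟩, ?_⟩
        change Nonempty (X ≃o SimplexJoinProd ((a : ℤ) - 2 + 2).toNat ((b : ℤ) - 2 + 2).toNat
          ((m : ℤ) - 2 + 2).toNat)
        rw [ha, hb, hm]
        exact ⟨f⟩
    · rintro (⟨b₁, b₂, ⟨h1, h2, h3⟩, ⟨f⟩⟩ | ⟨d₁, d₂, d₃, ⟨h1, h2, h3, h4⟩, ⟨f⟩⟩)
      · exact ⟨_, _, 0, ⟨by omega, by omega, by omega⟩, ⟨f.trans (joinOrderIso _ _)⟩⟩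
      · exact ⟨(d₁ + 2).toNat, (d₂ + 2).toNat, (d₃ + 2).toNat, ⟨by omega, by omega, by omega⟩, ⟨f⟩⟩
  · rintro b₁ b₂ c₁ c₂ ⟨h1, h2, -⟩ ⟨h1', h2', -⟩ ⟨f⟩
    have h := eq_of_simplexJoinProd_orderIso (by omega) (by omega) (by omega) (by omega)
      ⟨(joinOrderIso _ _).symm.trans (f.trans (joinOrderIso _ _))⟩
    rw [Prod.mk.injEq]
    omega
  · rintro d₁ d₂ d₃ e₁ e₂ e₃ ⟨h1, h2, h3, -⟩ ⟨h1', h2', h3', -⟩ f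
    have h := eq_of_simplexJoinProd_orderIso (by omega) (by omega) (by omega) (by omega) f
    rw [Prod.mk.injEq, Prod.mk.injEq]
    omega
  · rintro b₁ b₂ d₁ d₂ d₃ ⟨h1, h2, -⟩ ⟨h1', h2', h3', -⟩
    refine ⟨fun f => ?_⟩
    have h := eq_of_simplexJoinProd_orderIso (by omega) (by omega) (by omega) (by omega)
      ⟨(joinOrderIso _ _).symm.trans f⟩
    omega
  · rintro b₁ b₂ ⟨h1, h2, -⟩
    exact (isPolytopalSphere_simplexJoinProd (by omega) (by omega)).congr (joinOrderIso _ _).symm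
  · rintro d₁ d₂ d₃ ⟨h1, h2, -, -⟩
    exact isPolytopalSphere_simplexJoinProd (by omega) (by omega)
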